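/- Let $n\ge 1$ be an integer and let $\alpha>-1$, $N_s>0$ be real. For $T,t>0$ (treated as independent variables) let $$w(x,T,t)=x^{\alpha}e^{-x}\Big(\frac{t+x}{T+x}\Big)^{N_s},\qquad w_{\rm Lag}(x)=x^\alpha e^{-x},\qquad 0\le x<\infty,$$ let $D_n(T,t)=\det\big(\mu_{i+j}\big)_{i,j=0}^{n-1}$ with $\mu_k=\int_0^\infty x^k w(x,T,t)\,dx$, and let $$\mathcal M_\gamma(T,t)=\Big(\frac Tt\Big)^{nN_s}\, \frac{\frac1{n!}\int_{[0,\infty)^n}\prod_{i<j}(x_j-x_i)^2\prod_{k=1}^n w(x_k,T,t)\,dx_k} {\frac1{n!}\int_{[0,\infty)^n}\prod_{i<j}(x_j-x_i)^2\prod_{k=1}^n w_{\rm Lag}(x_k)\,dx_k}.$$ Then all moments $\mu_k$ converge, $D_n$ and $\mathcal M_\gamma$ are positive and three times continuously differentiable on $(0,\infty)^2$, and the function $$H_n(T,t):=(T\partial_T+t\partial_t)\log D_n(T,t)$$ is twice continuously differentiable there and satisfies $$H_n(T,t)=(T\partial_T+t\partial_t)\log\mathcal M_\gamma(T,t).$$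 For a function $H(T,t)$ put $\beta(H)=T\,\partial_TH+t\,\partial_tH-H+n(n+\alpha)$ and consider the double-time equation $$\begin{aligned} H={}&-2(\partial_TH)(\partial_tH)+(2n-N_s+\alpha+T)\,\partial_TH+(2n+N_s+\alpha+t)\,\partial_tH\pm A_1(H)\mp A_2(H)\\ &-\frac{\big[(T\partial^2_{TT}+t\partial^2_{Tt})H\big]\big[(T\partial^2_{Tt}+t\partial^2_{tt})H\big]+A_1(H)A_2(H)}{2\,\beta(H)}, \end{aligned}\tag{1}$$ where $$\{A_1(H)\}^2=\big((T\partial^2_{TT}+t\partial^2_{Tt})H\big)^2+4\,\beta(H)\,(\partial_TH)(\partial_TH-N_s),$$ $$\{A_2(H)\}^2=\big((T\partial^2_{Tt}+t\partial^2_{tt})H\big)^2+4\,\beta(H)\,(\partial_tH)(\partial_tH+N_s).$$ At every $(T,t)\in(0,\infty)^2$ one has $\beta(H_n)\neq0$, the two right-hand sides defining $A_1(H_n)^2$ and $A_2(H_n)^2$ are nonnegative, and $H_n$ satisfies (1): with the upper signs when $A_1(H_n),A_2(H_n)$ are the nonnegative square roots, equivalently with the lower signs when both are the nonpositive square roots.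 Moreover, (1) reduces to the Jimbo–Miwa–Okamoto $\sigma$-form of Painlevé V for functions of one variable. If $H(T,t)=Y(T)$ with $Y$ of class $C^2$ near $T>0$ and $\beta(H)=TY'-Y+n(n+\alpha)\ne0$ at $T$, then $H$ satisfies (1) at $(T,t)$ for some choice of the signs and of the real square roots $A_1,A_2$ if and only if, at $z=T$, $$(zY'')^2=\big(Y-zY'+2(Y')^2+(\nu_0+\nu_1+\nu_2+\nu_3)Y'\big)^2-4(\nu_0+Y')(\nu_1+Y')(\nu_2+Y')(\nu_3+Y')\tag{2}$$ with $\nu_0=0$, $\nu_1=-n-\alpha$, $\nu_2=-n$, $\nu_3=-N_s$. Likewise, if $H(T,t)=Y(t)$ with $Y$ of class $C^2$ near $t>0$ and $tY'-Y+n(n+\alpha)\neq0$ at $t$, then $H$ satisfies (1) at $(T,t)$ in the same sense if and only if (2) holds at $z=t$ with $\nu_0=0$, $\nu_1=-n-\alpha$, $\nu_2=-n$, $\nu_3=N_s$. -/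

import Mathlib

noncomputable section

/-! ## Weight, Hankel determinant, moment generating function -/

/-- The two-time deformed Laguerre weight `x^α e^{-x} ((t+x)/(T+x))^N` (for `0 ≤ x`). -/
def weightAF (α N T t x : ℝ) : ℝ :=
  x ^ α * Real.exp (-x) * ((t + x) / (T + x)) ^ N

/-- The classical Laguerre weight `x^α e^{-x}`. -/
def weightLag (α x : ℝ) : ℝ :=
  x ^ α * Real.exp (-x)

/-- The `k`-th moment `∫_0^∞ x^k w(x) dx`. -/
def moment (w : ℝ → ℝ) (k : ℕ) : ℝ :=
  ∫ x in Set.Ici (0 : ℝ), x ^ k * w x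

/-- The Hankel determinant `det (μ_{i+j})_{0 ≤ i, j ≤ n-1}` generated by the weight `w`. -/
def hankelDet (n : ℕ) (w : ℝ → ℝ) : ℝ :=
  Matrix.det (Matrix.of fun i j : Fin n => moment w ((i : ℕ) + (j : ℕ)))

/-- `D_n(T,t)`. -/
def hankelD (n : ℕ) (α N T t : ℝ) : ℝ :=
  hankelDet n (weightAF α N T t)

/-- `(1/n!) ∫_{[0,∞)^n} ∏_{i<j} (x_j - x_i)^2 ∏_k w(x_k) dx`. -/
def multipleIntegral (n : ℕ) (w : ℝ → ℝ) : ℝ :=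
  (1 / (n.factorial : ℝ)) *
    ∫ x in Set.pi Set.univ (fun _ : Fin n => Set.Ici (0 : ℝ)),
      (∏ i : Fin n, ∏ j ∈ Finset.Ioi i, (x j - x i) ^ 2) * ∏ k : Fin n, w (x k)

/-- The moment generating function `M_γ(T,t)` of the signal-to-noise ratio, as a function of the
two variables `(T,t)`, through its multiple integral representation. -/
def mgfSNR (n : ℕ) (α N T t : ℝ) : ℝ :=
  (T / t) ^ ((n : ℝ) * N) *
    (multipleIntegral n (weightAF α N T t) / multipleIntegral n (weightLag α))

/-! ## Partial derivatives -/

/-- `∂_T F`. -/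
def partialT (F : ℝ → ℝ → ℝ) (T t : ℝ) : ℝ :=
  deriv (fun x => F x t) T

/-- `∂_t F`. -/
def partialt (F : ℝ → ℝ → ℝ) (T t : ℝ) : ℝ :=
  deriv (fun y => F T y) t

/-- `(T ∂_T + t ∂_t) F`. -/
def eulerOp (F : ℝ → ℝ → ℝ) (T t : ℝ) : ℝ :=
  T * partialT F T t + t * partialt F T t

/-- `H_n(T,t) = (T ∂_T + t ∂_t) log D_n(T,t)`. -/
def hankelH (n : ℕ) (α N : ℝ) : ℝ → ℝ → ℝ :=
  eulerOp fun T t => Real.log (hankelD n α N T t)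

/-! ## The double-time equation for a function `H(T,t)` -/

/-- `T ∂_T H + t ∂_t H - H + n(n+α)`. -/
def betaOf (n : ℕ) (α : ℝ) (H : ℝ → ℝ → ℝ) (T t : ℝ) : ℝ :=
  T * partialT H T t + t * partialt H T t - H T t + n * (n + α)

/-- `(T ∂²_{TT} + t ∂²_{Tt}) H`. -/
def secondOp1 (H : ℝ → ℝ → ℝ) (T t : ℝ) : ℝ :=
  T * partialT (partialT H) T t + t * partialT (partialt H) T t

/-- `(T ∂²_{Tt} + t ∂²_{tt}) H`. -/
def secondOp2 (H : ℝ → ℝ → ℝ) (T t : ℝ) : ℝ :=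
  T * partialT (partialt H) T t + t * partialt (partialt H) T t

/-- The quantity whose square root is `A_1(H)`. -/
def radicand1 (n : ℕ) (α N : ℝ) (H : ℝ → ℝ → ℝ) (T t : ℝ) : ℝ :=
  secondOp1 H T t ^ 2 + 4 * betaOf n α H T t * partialT H T t * (partialT H T t - N)

/-- The quantity whose square root is `A_2(H)`. -/
def radicand2 (n : ℕ) (α N : ℝ) (H : ℝ → ℝ → ℝ) (T t : ℝ) : ℝ :=
  secondOp2 H T t ^ 2 + 4 * betaOf n α H T t * partialt H T t * (partialt H T t + N)

/-- The right-hand side of the double-time equation, with the terms `± A_1 ∓ A_2` written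
`ε A_1 - ε A_2`, `ε = ± 1`. -/
def doubleTimeRHS (n : ℕ) (α N : ℝ) (H : ℝ → ℝ → ℝ) (ε A₁ A₂ T t : ℝ) : ℝ :=
  -2 * partialT H T t * partialt H T t
    + (2 * n - N + α + T) * partialT H T t
    + (2 * n + N + α + t) * partialt H T t
    + ε * A₁ - ε * A₂
    - (secondOp1 H T t * secondOp2 H T t + A₁ * A₂) / (2 * betaOf n α H T t)

/-- `H` satisfies the double-time equation at `(T,t)` for some choice of the square roots
`A_1`, `A_2` and of the sign. -/
def SatisfiesDoubleTime (n : ℕ) (α N : ℝ) (H : ℝ → ℝ → ℝ) (T t : ℝ) : Prop :=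
  betaOf n α H T t ≠ 0 ∧
    ∃ ε A₁ A₂ : ℝ, (ε = 1 ∨ ε = -1) ∧
      A₁ ^ 2 = radicand1 n α N H T t ∧ A₂ ^ 2 = radicand2 n α N H T t ∧
      H T t = doubleTimeRHS n α N H ε A₁ A₂ T t

/-- The Jimbo–Miwa–Okamoto `σ`-form of Painlevé V with parameters `ν₀, ν₁, ν₂, ν₃`, for a function
`Y` of one variable, at the point `z`. -/
def SatisfiesSigmaPV (ν₀ ν₁ ν₂ ν₃ : ℝ) (Y : ℝ → ℝ) (z : ℝ) : Prop :=
  (z * deriv (deriv Y) z) ^ 2 =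
    (Y z - z * deriv Y z + 2 * deriv Y z ^ 2 + (ν₀ + ν₁ + ν₂ + ν₃) * deriv Y z) ^ 2
      - 4 * (ν₀ + deriv Y z) * (ν₁ + deriv Y z) * (ν₂ + deriv Y z) * (ν₃ + deriv Y z)

end

/-!
Write `w` for the weight, `P_n` for its monic orthogonal polynomials, `h_n = D_{n+1} / D_n` for their
squared norms and `⟨·⟩` for integration against `w`. The proof expresses every quantity in the
double-time equation through

* `S_n = N ⟨P_n² / (x + T)⟩ / h_n`, `p = N ⟨P_n P_{n-1} / (x + T)⟩ / h_{n-1}`,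
* `R_n = N ⟨P_n² / (x + t)⟩ / h_n`, `q = -N ⟨P_n P_{n-1} / (x + t)⟩ / h_{n-1}`.

Differentiating the orthogonality relations gives `∂_T log h_n = -S_n`, `∂_t log h_n = R_n`, and, for
the subleading coefficient `p₁` of `P_n`, `∂_T p₁ = p` and `∂_t p₁ = q`
(`hasDerivAt_log_det`, `hasDerivAt_subCoeff`). Integration by parts (the Pearson relation for `w`)
tested on `P_j²` and summed over `j < n` shows `H_n = n (n + α) + p₁`, and tested on `P_n P_{n-1}` it
shows that `β(H_n) = h_n / h_{n-1}`, which is positive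
(`hankelH_eq_subCoeff`, `betaOf_hankelH`). Hence `∂_T H_n = p`, `∂_t H_n = q`. Since
`(T ∂²_{TT} + t ∂²_{Tt}) H = ∂_T β(H)` identically, the second order expressions are
`∂_T β = β (S_{n-1} - S_n)` and `∂_t β = β (R_n - R_{n-1})`.

The equation itself comes from three instances of one algebraic fact
(`mul_eq_of_map_X_sub_C_mul`). If a functional `M` on polynomials satisfies `M ((x - c) g) = κ ⟨g⟩`,
division by `x - c` shows that `M (P_n²) M (P_{n-1}²) = M (P_n P_{n-1}) (M (P_n P_{n-1}) - κ h_{n-1})`.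
For `c = -T` and `c = -t` this reads `β S_n S_{n-1} = p (p - N)` and `β R_n R_{n-1} = q (q + N)`, which
makes the two radicands the squares of `β (S_n + S_{n-1})` and `β (R_n + R_{n-1})`; as `S` and `R` are
nonnegative, these are the nonnegative roots. For `c = 0`, with the functional
`f ↦ ⟨f⟩ - N ⟨f / (x + t)⟩ + N ⟨f / (x + T)⟩ - ⟨f'⟩` (the regularised `α ⟨f / x⟩`), it reads
`β (1 - R_n + S_n) (1 - R_{n-1} + S_{n-1}) = (q + p - n) (q + p - n - α)`. The double-time equation is a
linear combination of the three relations and the definition of `β(H)`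
(`doubleTime_of_quadratic_relations`). No step divides by `T - t`, so the diagonal `T = t` needs no
separate treatment.

Smoothness comes from differentiating the family `∫ x^s e^{-x} (t + x)^a (T + x)^b dx` under the
integral sign; positivity of `D_n` from the Gram structure of the Hankel matrix; the moment generating
function is reduced to `D_n` by Heine's identity (`multipleIntegral_eq_hankelDet`); and the reductions
to Painlevé V are polynomial identities, one of the two square roots being zero.
-/

noncomputable section

open Polynomial MeasureTheory Set

/-! ### Orthogonal polynomials of a moment sequence -/

/-- The Hankel matrix `(μ_{i+j})_{0 ≤ i, j < n}` of an arbitrary real sequence `μ`. -/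
def hankelMatrix (μ : ℕ → ℝ) (n : ℕ) : Matrix (Fin n) (Fin n) ℝ :=
  Matrix.of fun i j : Fin n => μ ((i : ℕ) + (j : ℕ))

/-- The linear functional on polynomials with moments `μ`, that is `X ^ k ↦ μ k`. -/
def momentFunctional (μ : ℕ → ℝ) : ℝ[X] →ₗ[ℝ] ℝ :=
  (Polynomial.basisMonomials ℝ).constr ℝ μ

theorem momentFunctional_X_pow (μ : ℕ → ℝ) (k : ℕ) : momentFunctional μ (X ^ k) = μ k := by
  simpa [momentFunctional, Polynomial.monomial_one_right_eq_X_pow] using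
    (Polynomial.basisMonomials ℝ).constr_basis ℝ μ k

theorem momentFunctional_C_mul (μ : ℕ → ℝ) (a : ℝ) (f : ℝ[X]) :
    momentFunctional μ (C a * f) = a * momentFunctional μ f := by
  rw [← Polynomial.smul_eq_C_mul, map_smul, smul_eq_mul]

/-- Two linear functionals agree on all polynomials as soon as they agree on the powers of `X`. -/
theorem linearMap_eq_of_X_pow {φ ψ : ℝ[X] →ₗ[ℝ] ℝ} (h : ∀ k : ℕ, φ (X ^ k) = ψ (X ^ k))
    (f : ℝ[X]) : φ f = ψ f := by
  have : φ = ψ := by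
    ext k
    simpa [Polynomial.monomial_one_right_eq_X_pow] using h k
  rw [this]

/-- The monic orthogonal polynomial `P_n` for the moments `μ`. Its coefficients are the last column
of the adjugate of the Hankel matrix of size `n + 1`, divided by `D_n`, so that the orthogonality
relations are the last column of `A * adjugate A = det A • 1`. It is monic only if `D_n ≠ 0`. -/
def orthPoly (μ : ℕ → ℝ) (n : ℕ) : ℝ[X] :=
  ∑ i : Fin (n + 1), C ((hankelMatrix μ (n + 1)).adjugate i (Fin.last n) /
    (hankelMatrix μ n).det) * X ^ (i : ℕ)

/-- The squared norm `h_n = D_{n+1} / D_n` of `orthPoly μ n`. -/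
def sqNorm (μ : ℕ → ℝ) (n : ℕ) : ℝ :=
  (hankelMatrix μ (n + 1)).det / (hankelMatrix μ n).det

/-- The coefficient of `X ^ (n - 1)` in `orthPoly μ n`; multiplication by `X` makes it `0` for
`n = 0`. -/
def subCoeff (μ : ℕ → ℝ) (n : ℕ) : ℝ :=
  (X * orthPoly μ n).coeff n

theorem adjugate_hankelMatrix_last (μ : ℕ → ℝ) (n : ℕ) :
    (hankelMatrix μ (n + 1)).adjugate (Fin.last n) (Fin.last n) = (hankelMatrix μ n).det := by
  rw [Matrix.adjugate_fin_succ_eq_det_submatrix]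
  have : (hankelMatrix μ (n + 1)).submatrix (Fin.last n).succAbove (Fin.last n).succAbove
      = hankelMatrix μ n := by
    ext i j
    simp [hankelMatrix]
  rw [this, ← two_mul, pow_mul]
  simp

theorem sum_hankelMatrix_mul_adjugate (μ : ℕ → ℝ) (n : ℕ) (k : Fin (n + 1)) :
    ∑ i : Fin (n + 1), μ (k + i) * (hankelMatrix μ (n + 1)).adjugate i (Fin.last n) =
      if k = Fin.last n then (hankelMatrix μ (n + 1)).det else 0 := by
  have h := congrFun (congrFun (Matrix.mul_adjugate (hankelMatrix μ (n + 1))) k) (Fin.last n)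
  rw [Matrix.mul_apply] at h
  simpa [hankelMatrix, Matrix.one_apply] using h

theorem coeff_sum_fin (n : ℕ) (a : Fin (n + 1) → ℝ) (k : ℕ) :
    (∑ i : Fin (n + 1), C (a i) * X ^ (i : ℕ)).coeff k =
      if h : k < n + 1 then a ⟨k, h⟩ else 0 := by
  rw [finsetSum_coeff]
  simp only [coeff_C_mul_X_pow]
  split_ifs with h
  · rw [Finset.sum_eq_single ⟨k, h⟩] 
    · simp
    · intro b _ hb
      rw [if_neg]
      intro hk
      exact hb (Fin.ext hk.symm)
    · simp
  · apply Finset.sum_eq_zero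
    intro i _
    rw [if_neg]
    have := i.2
    omega

theorem natDegree_sum_fin_le (n : ℕ) (a : Fin (n + 1) → ℝ) :
    (∑ i : Fin (n + 1), C (a i) * X ^ (i : ℕ)).natDegree ≤ n := by
  rw [natDegree_le_iff_coeff_eq_zero]
  intro k hk
  rw [coeff_sum_fin, dif_neg (by omega)]

/-- A linear functional on polynomials of degree at most `n` that vanishes on `1, …, X ^ (n - 1)`
is a multiple of the leading coefficient. -/
theorem linearMap_eq_coeff_mul {φ : ℝ[X] →ₗ[ℝ] ℝ} {n : ℕ} {d : ℝ}
    (h : ∀ k : Fin (n + 1), φ (X ^ (k : ℕ)) = if k = Fin.last n then d else 0)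
    {q : ℝ[X]} (hq : q.natDegree ≤ n) : φ q = q.coeff n * d := by
  conv_lhs => rw [q.as_sum_range_C_mul_X_pow' (Nat.lt_succ_of_le hq)]
  rw [map_sum, Finset.sum_range_succ, Finset.sum_eq_zero, zero_add]
  · have := h (Fin.last n)
    simp only [Fin.val_last, if_true] at this
    rw [← Polynomial.smul_eq_C_mul, map_smul, this, smul_eq_mul]
  · intro k hk
    rw [Finset.mem_range] at hk
    have := h ⟨k, by omega⟩
    rw [if_neg (by intro h'; simp [Fin.ext_iff] at h'; omega)] at this
    rw [← Polynomial.smul_eq_C_mul, map_smul]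
    simp only [] at this
    rw [this, smul_zero]

theorem natDegree_orthPoly_le (μ : ℕ → ℝ) (n : ℕ) : (orthPoly μ n).natDegree ≤ n :=
  natDegree_sum_fin_le n _

theorem coeff_orthPoly_self {μ : ℕ → ℝ} (hD : ∀ n, (hankelMatrix μ n).det ≠ 0) (n : ℕ) :
    (orthPoly μ n).coeff n = 1 := by
  rw [orthPoly, coeff_sum_fin, dif_pos (Nat.lt_succ_self n)]
  change (hankelMatrix μ (n + 1)).adjugate (Fin.last n) (Fin.last n) / _ = 1
  rw [adjugate_hankelMatrix_last, div_self (hD n)]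

theorem subCoeff_succ (μ : ℕ → ℝ) (n : ℕ) :
    subCoeff μ (n + 1) = (orthPoly μ (n + 1)).coeff n := by
  rw [subCoeff, coeff_X_mul]

theorem subCoeff_zero (μ : ℕ → ℝ) : subCoeff μ 0 = 0 := by
  simp [subCoeff]

theorem sqNorm_ne_zero {μ : ℕ → ℝ} (hD : ∀ n, (hankelMatrix μ n).det ≠ 0) (n : ℕ) :
    sqNorm μ n ≠ 0 := div_ne_zero (hD _) (hD _)

/-- Orthogonality: `orthPoly μ n` is orthogonal to all lower powers, and pairs with `X ^ n` to
`sqNorm μ n`. -/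
theorem momentFunctional_orthPoly_mul (μ : ℕ → ℝ) (n : ℕ) {q : ℝ[X]} (hq : q.natDegree ≤ n) :
    momentFunctional μ (orthPoly μ n * q) = q.coeff n * sqNorm μ n := by
  refine linearMap_eq_coeff_mul (φ := momentFunctional μ ∘ₗ LinearMap.mulLeft ℝ (orthPoly μ n))
    (fun k => ?_) hq
  rw [LinearMap.comp_apply, LinearMap.mulLeft_apply, orthPoly, Finset.sum_mul, map_sum]
  have h := sum_hankelMatrix_mul_adjugate μ n k
  calc _ = ∑ i : Fin (n + 1), (μ (k + i) * (hankelMatrix μ (n + 1)).adjugate i (Fin.last n)) /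
        (hankelMatrix μ n).det := by
        refine Finset.sum_congr rfl fun i _ => ?_
        rw [mul_assoc, ← pow_add, momentFunctional_C_mul, momentFunctional_X_pow, add_comm (i : ℕ)]
        ring
    _ = _ := by
        rw [← Finset.sum_div, h, sqNorm]
        split_ifs <;> simp

theorem momentFunctional_orthPoly_mul_of_lt {μ : ℕ → ℝ} {j : ℕ} {q : ℝ[X]} (hq : q.natDegree < j) :
    momentFunctional μ (orthPoly μ j * q) = 0 := by
  rw [momentFunctional_orthPoly_mul μ j hq.le, coeff_eq_zero_of_natDegree_lt hq, zero_mul]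

/-- Let `L` be the moment functional and suppose `M ((X - c) g) = κ L g` for all `g`. Then the values
of `M` on the products of `P_{n+1}` and `P_n` satisfy a quadratic relation. By division by `X - c`
and orthogonality, they factor as `M (P_m ^ 2) = P_m(c) M(P_m)` and
`M (P_{n+1} P_n) = P_n(c) M(P_{n+1}) = P_{n+1}(c) M(P_n) + κ h_n`. -/
theorem mul_eq_of_map_X_sub_C_mul {μ : ℕ → ℝ} (hD : ∀ n, (hankelMatrix μ n).det ≠ 0)
    {M : ℝ[X] →ₗ[ℝ] ℝ} {c κ : ℝ} (hM : ∀ g, M ((X - C c) * g) = κ * momentFunctional μ g) (n : ℕ) :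
    M (orthPoly μ (n + 1) * orthPoly μ (n + 1)) * M (orthPoly μ n * orthPoly μ n) =
      M (orthPoly μ (n + 1) * orthPoly μ n) *
        (M (orthPoly μ (n + 1) * orthPoly μ n) - κ * sqNorm μ n) := by
  have key : ∀ (p q : ℝ[X]), M (p * q) =
      κ * momentFunctional μ (p * (q /ₘ (X - C c))) + q.eval c * M p := by
    intro p q
    have h1 : q = (X - C c) * (q /ₘ (X - C c)) + C (q.eval c) := by
      conv_lhs => rw [← modByMonic_add_div q (X - C c), modByMonic_X_sub_C_eq_C_eval]
      ring
    have h2 : p * q = (X - C c) * (p * (q /ₘ (X - C c))) + C (q.eval c) * p := by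
      conv_lhs => rw [h1]
      ring
    rw [h2, map_add, hM, ← Polynomial.smul_eq_C_mul, map_smul, smul_eq_mul]
  have hdeg : ∀ q : ℝ[X], (q /ₘ (X - C c)).natDegree = q.natDegree - 1 := by
    intro q
    rw [natDegree_divByMonic _ (monic_X_sub_C c), natDegree_X_sub_C]
  have hzero : ∀ (m : ℕ) (q : ℝ[X]), q.natDegree ≤ m → q.coeff m = 0 →
      momentFunctional μ (orthPoly μ m * q) = 0 := by
    intro m q h1 h2
    rw [momentFunctional_orthPoly_mul μ m h1, h2, zero_mul]
  have hlow : ∀ (m : ℕ) (q : ℝ[X]), q.natDegree ≤ m →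
      momentFunctional μ (orthPoly μ m * (q /ₘ (X - C c))) = 0 := by
    intro m q h1
    rcases Nat.eq_zero_or_pos m with rfl | hm
    · have : q /ₘ (X - C c) = 0 := by
        rw [divByMonic_eq_zero_iff (monic_X_sub_C c), degree_X_sub_C]
        exact lt_of_le_of_lt (degree_le_of_natDegree_le h1) (by norm_num)
      rw [this, mul_zero, map_zero]
    · refine hzero m _ ?_ ?_
      · rw [hdeg]; omega
      · apply coeff_eq_zero_of_natDegree_lt
        rw [hdeg]; omega
  have e1 := key (orthPoly μ (n + 1)) (orthPoly μ (n + 1))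
  have e2 := key (orthPoly μ (n + 1)) (orthPoly μ n)
  have e3 := key (orthPoly μ n) (orthPoly μ n)
  have e4 := key (orthPoly μ n) (orthPoly μ (n + 1))
  rw [hlow _ _ (natDegree_orthPoly_le μ _), mul_zero, zero_add] at e1 e3
  rw [hlow _ _ ((natDegree_orthPoly_le μ _).trans (Nat.le_succ n)), mul_zero, zero_add] at e2
  have hc : (orthPoly μ (n + 1) /ₘ (X - C c)).coeff n = 1 := by
    have h1 : orthPoly μ (n + 1) = (X - C c) * (orthPoly μ (n + 1) /ₘ (X - C c))
        + C ((orthPoly μ (n + 1)).eval c) := by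
      conv_lhs => rw [← modByMonic_add_div (orthPoly μ (n + 1)) (X - C c),
        modByMonic_X_sub_C_eq_C_eval]
      ring
    have h2 := coeff_orthPoly_self hD (n + 1)
    rw [h1, sub_mul, coeff_add, coeff_sub, coeff_X_mul, coeff_C_mul, coeff_C_succ,
      coeff_eq_zero_of_natDegree_lt (n := n + 1)] at h2
    · simpa using h2
    · rw [hdeg]
      have := natDegree_orthPoly_le μ (n + 1)
      omega
  rw [momentFunctional_orthPoly_mul μ n (by
    rw [hdeg]; have := natDegree_orthPoly_le μ (n + 1); omega), hc, one_mul, mul_comm (orthPoly μ n)]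
    at e4
  have e5 : M (orthPoly μ (n + 1) * orthPoly μ n) - κ * sqNorm μ n =
      (orthPoly μ (n + 1)).eval c * M (orthPoly μ n) := by rw [e4]; ring
  rw [e5, e1, e2, e3]
  ring

/-! ### Semi-classical relations for the two-time Laguerre moments -/

/-- The relations between the moments `μ` of the weight `w = x^α e^{-x} ((t + x) / (T + x))^N` and
the moments `μT`, `μt` of `w / (x + T)`, `w / (x + t)` from which the algebraic part of the argument
is drawn. The field `pearson` expresses `∫ (x^{k+1} w)' dx = 0`, after
`x / (x + c) = 1 - c / (x + c)` has been used for `c = t` and `c = T`. -/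
structure IsTwoTimeLaguerre (α N T t : ℝ) (μ μT μt : ℕ → ℝ) : Prop where
  det_ne_zero : ∀ n, (hankelMatrix μ n).det ≠ 0
  succ_T : ∀ k, μT (k + 1) + T * μT k = μ k
  succ_t : ∀ k, μt (k + 1) + t * μt k = μ k
  pearson : ∀ k : ℕ, (k + 1 + α) * μ k - μ (k + 1) - N * t * μt k + N * T * μT k = 0

/-- If `ν` are the moments of `w / (x + c)` and `μ` those of `w`, then multiplication by `x + c`
turns the functional of `ν` into that of `μ`. -/
theorem momentFunctional_X_sub_C_mul {μ ν : ℕ → ℝ} {c : ℝ}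
    (h : ∀ k, ν (k + 1) + c * ν k = μ k) (g : ℝ[X]) :
    momentFunctional ν ((X - C (-c)) * g) = momentFunctional μ g := by
  have key := linearMap_eq_of_X_pow (φ := momentFunctional ν ∘ₗ LinearMap.mulLeft ℝ (X - C (-c)))
    (ψ := momentFunctional μ) (fun k => ?_) g
  · exact key
  rw [LinearMap.comp_apply, LinearMap.mulLeft_apply, sub_mul, map_sub, ← pow_succ',
    momentFunctional_C_mul, momentFunctional_X_pow, momentFunctional_X_pow, momentFunctional_X_pow,
    ← h k]
  ring

theorem coeff_X_mul_derivative (f : ℝ[X]) (k : ℕ) :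
    (X * derivative f).coeff k = k * f.coeff k := by
  rcases k with _ | k
  · simp
  · rw [coeff_X_mul, coeff_derivative]; push_cast; ring

theorem natDegree_X_mul_derivative_le {f : ℝ[X]} {n : ℕ} (hf : f.natDegree ≤ n) :
    (X * derivative f).natDegree ≤ n := by
  rw [natDegree_le_iff_coeff_eq_zero]
  intro k hk
  rw [coeff_X_mul_derivative, coeff_eq_zero_of_natDegree_lt (hf.trans_lt hk), mul_zero]

namespace IsTwoTimeLaguerre

variable {α N T t : ℝ} {μ μT μt : ℕ → ℝ}

/-- The Pearson relation for polynomials, `∫ (x f w)' dx = 0`. -/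
theorem pearson_poly (H : IsTwoTimeLaguerre α N T t μ μT μt) (f : ℝ[X]) :
    momentFunctional μ (X * derivative f) + (1 + α) * momentFunctional μ f
      - momentFunctional μ (X * f) - N * t * momentFunctional μt f
      + N * T * momentFunctional μT f = 0 := by
  have h := linearMap_eq_of_X_pow
    (φ := momentFunctional μ ∘ₗ LinearMap.mulLeft ℝ X ∘ₗ derivative
      + (1 + α) • momentFunctional μ - momentFunctional μ ∘ₗ LinearMap.mulLeft ℝ X
      - (N * t) • momentFunctional μt + (N * T) • momentFunctional μT) (ψ := 0) (fun k => ?_) f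
  · simpa using h
  · have h1 : X * derivative (X ^ k : ℝ[X]) = C (k : ℝ) * X ^ k := by
      rcases k with _ | k
      · simp
      · rw [derivative_X_pow]
        push_cast
        ring_nf
    have h2 := H.pearson k
    simp only [LinearMap.add_apply, LinearMap.sub_apply, LinearMap.comp_apply,
      LinearMap.mulLeft_apply, LinearMap.smul_apply, smul_eq_mul, h1, momentFunctional_C_mul,
      ← pow_succ', momentFunctional_X_pow, LinearMap.zero_apply]
    linarith

/-- The recurrence coefficient `⟨x P_j²⟩ / ⟨P_j²⟩` in terms of subleading coefficients. -/
theorem map_X_mul_sq (H : IsTwoTimeLaguerre α N T t μ μT μt) (j : ℕ) :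
    momentFunctional μ (X * (orthPoly μ j * orthPoly μ j)) =
      (subCoeff μ j - subCoeff μ (j + 1)) * sqNorm μ j := by
  have h1 : X * (orthPoly μ j * orthPoly μ j) =
      orthPoly μ j * (X * orthPoly μ j - orthPoly μ (j + 1)) + orthPoly μ (j + 1) * orthPoly μ j := by
    ring
  have hP := natDegree_orthPoly_le μ j
  have hX : (X * orthPoly μ j).natDegree ≤ j + 1 := by
    refine natDegree_mul_le.trans ?_
    rw [natDegree_X]; omega
  have hd : (X * orthPoly μ j - orthPoly μ (j + 1)).natDegree ≤ j := by
    rw [natDegree_le_iff_coeff_eq_zero]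
    intro k hk
    rcases Nat.lt_or_ge (j + 1) k with h | h
    · rw [coeff_sub, coeff_eq_zero_of_natDegree_lt (hX.trans_lt h),
        coeff_eq_zero_of_natDegree_lt ((natDegree_orthPoly_le μ (j + 1)).trans_lt h), sub_zero]
    · obtain rfl : k = j + 1 := by omega
      rw [coeff_sub, coeff_X_mul, coeff_orthPoly_self H.det_ne_zero,
        coeff_orthPoly_self H.det_ne_zero, sub_self]
  rw [h1, map_add, momentFunctional_orthPoly_mul μ j hd,
    momentFunctional_orthPoly_mul μ (j + 1) (hP.trans (Nat.le_succ j)),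
    coeff_eq_zero_of_natDegree_lt (hP.trans_lt (Nat.lt_succ_self j)), coeff_sub, subCoeff_succ]
  simp [subCoeff]

theorem map_sq (H : IsTwoTimeLaguerre α N T t μ μT μt) (j : ℕ) :
    momentFunctional μ (orthPoly μ j * orthPoly μ j) = sqNorm μ j := by
  rw [momentFunctional_orthPoly_mul μ j (natDegree_orthPoly_le μ j),
    coeff_orthPoly_self H.det_ne_zero, one_mul]

/-- The Pearson relation tested on `P_j²`. -/
theorem pearson_sq (H : IsTwoTimeLaguerre α N T t μ μT μt) (j : ℕ) :
    N * t * momentFunctional μt (orthPoly μ j * orthPoly μ j)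
      - N * T * momentFunctional μT (orthPoly μ j * orthPoly μ j) =
      (2 * j + 1 + α - subCoeff μ j + subCoeff μ (j + 1)) * sqNorm μ j := by
  have h := H.pearson_poly (orthPoly μ j * orthPoly μ j)
  have h1 : X * derivative (orthPoly μ j * orthPoly μ j) =
      orthPoly μ j * (X * derivative (orthPoly μ j)) +
      orthPoly μ j * (X * derivative (orthPoly μ j)) := by
    rw [derivative_mul]; ring
  rw [h1, map_add, momentFunctional_orthPoly_mul μ j
    (natDegree_X_mul_derivative_le (natDegree_orthPoly_le μ j)), coeff_X_mul_derivative,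
    coeff_orthPoly_self H.det_ne_zero, H.map_sq, H.map_X_mul_sq] at h
  linarith

/-- The Pearson relation tested on `P_{n+1} P_n`. -/
theorem pearson_mul (H : IsTwoTimeLaguerre α N T t μ μT μt) (n : ℕ) :
    N * t * momentFunctional μt (orthPoly μ (n + 1) * orthPoly μ n)
      - N * T * momentFunctional μT (orthPoly μ (n + 1) * orthPoly μ n) =
      -subCoeff μ (n + 1) * sqNorm μ n - sqNorm μ (n + 1) := by
  have h := H.pearson_poly (orthPoly μ (n + 1) * orthPoly μ n)
  have hP := natDegree_orthPoly_le μ n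
  have hP' := natDegree_orthPoly_le μ (n + 1)
  have h1 : X * derivative (orthPoly μ (n + 1) * orthPoly μ n) =
      orthPoly μ (n + 1) * (X * derivative (orthPoly μ n)) +
      (orthPoly μ n * (X * derivative (orthPoly μ (n + 1)) - C ((n : ℝ) + 1) * orthPoly μ (n + 1))
      + C ((n : ℝ) + 1) * (orthPoly μ (n + 1) * orthPoly μ n)) := by
    rw [derivative_mul]; ring
  have hd : (X * derivative (orthPoly μ (n + 1)) - C ((n : ℝ) + 1) * orthPoly μ (n + 1)).natDegree
      ≤ n := by
    rw [natDegree_le_iff_coeff_eq_zero]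
    intro k hk
    rw [coeff_sub, coeff_X_mul_derivative, coeff_C_mul]
    rcases Nat.lt_or_ge (n + 1) k with h | h
    · rw [coeff_eq_zero_of_natDegree_lt (hP'.trans_lt h)]; simp
    · obtain rfl : k = n + 1 := by omega
      push_cast; ring
  have h2 : X * (orthPoly μ (n + 1) * orthPoly μ n) = orthPoly μ (n + 1) * (X * orthPoly μ n) := by
    ring
  rw [h1, h2, map_add, map_add, momentFunctional_C_mul,
    momentFunctional_orthPoly_mul_of_lt ((natDegree_X_mul_derivative_le hP).trans_lt (Nat.lt_succ_self n)),
    momentFunctional_orthPoly_mul_of_lt (hP.trans_lt (Nat.lt_succ_self n)),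
    momentFunctional_orthPoly_mul μ n hd,
    momentFunctional_orthPoly_mul μ (n + 1) (by
      refine natDegree_mul_le.trans ?_
      rw [natDegree_X]; omega), coeff_X_mul, coeff_orthPoly_self H.det_ne_zero, coeff_sub,
    coeff_X_mul_derivative, coeff_C_mul, ← subCoeff_succ] at h
  linarith

/-- The quadratic relation at the singular point `-T` of the weight. -/
theorem quad_T (H : IsTwoTimeLaguerre α N T t μ μT μt) (n : ℕ) :
    momentFunctional μT (orthPoly μ (n + 1) * orthPoly μ (n + 1)) *
      momentFunctional μT (orthPoly μ n * orthPoly μ n) =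
      momentFunctional μT (orthPoly μ (n + 1) * orthPoly μ n) *
        (momentFunctional μT (orthPoly μ (n + 1) * orthPoly μ n) - sqNorm μ n) := by
  have := mul_eq_of_map_X_sub_C_mul H.det_ne_zero (M := momentFunctional μT) (κ := 1) (c := -T)
    (fun g => by rw [momentFunctional_X_sub_C_mul H.succ_T, one_mul]) n
  rwa [one_mul] at this

/-- The quadratic relation at the singular point `-t` of the weight. -/
theorem quad_t (H : IsTwoTimeLaguerre α N T t μ μT μt) (n : ℕ) :
    momentFunctional μt (orthPoly μ (n + 1) * orthPoly μ (n + 1)) *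
      momentFunctional μt (orthPoly μ n * orthPoly μ n) =
      momentFunctional μt (orthPoly μ (n + 1) * orthPoly μ n) *
        (momentFunctional μt (orthPoly μ (n + 1) * orthPoly μ n) - sqNorm μ n) := by
  have := mul_eq_of_map_X_sub_C_mul H.det_ne_zero (M := momentFunctional μt) (κ := 1) (c := -t)
    (fun g => by rw [momentFunctional_X_sub_C_mul H.succ_t, one_mul]) n
  rwa [one_mul] at this

/-- The quadratic relation at the singular point `0` of the weight. The functional
`f ↦ ⟨f⟩ - N ⟨f / (x + t)⟩ + N ⟨f / (x + T)⟩ - ⟨f'⟩` is the regularisation of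
`f ↦ α ⟨f / x⟩`, which itself diverges for `α ≤ 0`. -/
theorem quad_zero (H : IsTwoTimeLaguerre α N T t μ μT μt) (n : ℕ) :
    (sqNorm μ (n + 1) - N * momentFunctional μt (orthPoly μ (n + 1) * orthPoly μ (n + 1))
        + N * momentFunctional μT (orthPoly μ (n + 1) * orthPoly μ (n + 1))) *
      (sqNorm μ n - N * momentFunctional μt (orthPoly μ n * orthPoly μ n)
        + N * momentFunctional μT (orthPoly μ n * orthPoly μ n)) =
      (-((n : ℝ) + 1) * sqNorm μ n - N * momentFunctional μt (orthPoly μ (n + 1) * orthPoly μ n)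
        + N * momentFunctional μT (orthPoly μ (n + 1) * orthPoly μ n)) *
      (-((n : ℝ) + 1) * sqNorm μ n - N * momentFunctional μt (orthPoly μ (n + 1) * orthPoly μ n)
        + N * momentFunctional μT (orthPoly μ (n + 1) * orthPoly μ n) - α * sqNorm μ n) := by
  set M : ℝ[X] →ₗ[ℝ] ℝ := momentFunctional μ - N • momentFunctional μt + N • momentFunctional μT
    - momentFunctional μ ∘ₗ derivative with hMdef
  have hMf : ∀ f, M f = momentFunctional μ f - N * momentFunctional μt f
      + N * momentFunctional μT f - momentFunctional μ (derivative f) := fun f => by simp [hMdef]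
  -- the Pearson relation for `g`
  have hM : ∀ g, M ((X - C 0) * g) = α * momentFunctional μ g := by
    intro g
    have hT := momentFunctional_X_sub_C_mul H.succ_T g
    have ht := momentFunctional_X_sub_C_mul H.succ_t g
    rw [sub_mul, map_sub, momentFunctional_C_mul] at hT ht
    have hp := H.pearson_poly g
    rw [C_0, sub_zero, hMf, derivative_mul, derivative_X, one_mul, map_add]
    linear_combination (-1 : ℝ) * hp + N * hT - N * ht
  have h := mul_eq_of_map_X_sub_C_mul H.det_ne_zero hM n
  have hP := natDegree_orthPoly_le μ n
  have hP' := natDegree_orthPoly_le μ (n + 1)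
  have hlt : ∀ {f : ℝ[X]} {m : ℕ}, f.natDegree ≤ m + 1 → (derivative f).natDegree ≤ m :=
    fun hf => (natDegree_derivative_le _).trans (by omega)
  have hsq : ∀ m, momentFunctional μ (derivative (orthPoly μ m * orthPoly μ m)) = 0 := by
    intro m
    have h0 : momentFunctional μ (orthPoly μ m * derivative (orthPoly μ m)) = 0 := by
      rcases m with _ | m
      · have : (orthPoly μ 0).natDegree = 0 := Nat.le_zero.mp (natDegree_orthPoly_le μ 0)
        rw [derivative_of_natDegree_zero this, mul_zero, map_zero]
      · exact momentFunctional_orthPoly_mul_of_lt (Nat.lt_succ_of_le (hlt (natDegree_orthPoly_le μ (m + 1))))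
    rw [derivative_mul, map_add, mul_comm (derivative _), h0, add_zero]
  have hmul : momentFunctional μ (derivative (orthPoly μ (n + 1) * orthPoly μ n)) =
      ((n : ℝ) + 1) * sqNorm μ n := by
    rw [derivative_mul, map_add, mul_comm (derivative _),
      momentFunctional_orthPoly_mul μ n (hlt hP'), coeff_derivative,
      coeff_orthPoly_self H.det_ne_zero, one_mul,
      momentFunctional_orthPoly_mul_of_lt ((hlt (hP.trans (Nat.le_succ n))).trans_lt (Nat.lt_succ_self n)), add_zero]
  rw [hMf, hMf, hMf, hsq, hsq, hmul, H.map_sq, H.map_sq,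
    momentFunctional_orthPoly_mul_of_lt (hP.trans_lt (Nat.lt_succ_self n))] at h
  linear_combination h

end IsTwoTimeLaguerre

/-! ### Variation of Hankel determinants and orthogonal polynomials -/

theorem differentiableAt_det {m : ℕ} {A : ℝ → Matrix (Fin m) (Fin m) ℝ} {s : ℝ}
    (h : ∀ i j, DifferentiableAt ℝ (fun x => A x i j) s) :
    DifferentiableAt ℝ (fun x => (A x).det) s := by
  simp only [Matrix.det_apply]
  fun_prop

theorem differentiableAt_adjugate {m : ℕ} {A : ℝ → Matrix (Fin (m + 1)) (Fin (m + 1)) ℝ} {s : ℝ}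
    (h : ∀ i j, DifferentiableAt ℝ (fun x => A x i j) s) (i j : Fin (m + 1)) :
    DifferentiableAt ℝ (fun x => (A x).adjugate i j) s := by
  simp only [Matrix.adjugate_fin_succ_eq_det_submatrix]
  refine DifferentiableAt.const_mul (differentiableAt_det fun i j => ?_) _
  simpa using h _ _

/-- First variation of the orthogonality relations along a curve of moments. The unnormalised
polynomial `D_n P_n`, whose coefficients are entries of the adjugate, is used because its relations
hold without any condition on `D_n`, hence in a neighbourhood of `s`. -/
theorem variation_orthogonality {μ : ℝ → ℕ → ℝ} {μ' : ℕ → ℝ} {s : ℝ}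
    (hμ : ∀ k, HasDerivAt (fun x => μ x k) (μ' k) s)
    (hD : ∀ n, (hankelMatrix (μ s) n).det ≠ 0) (n : ℕ) {q : ℝ[X]} (hq : q.natDegree ≤ n) :
    (hankelMatrix (μ s) n).det * momentFunctional μ' (orthPoly (μ s) n * q) +
      momentFunctional (μ s) ((∑ i : Fin (n + 1), C (deriv
        (fun x => (hankelMatrix (μ x) (n + 1)).adjugate i (Fin.last n)) s) * X ^ (i : ℕ)) * q) =
      q.coeff n * deriv (fun x => (hankelMatrix (μ x) (n + 1)).det) s := by
  set Q : ℝ[X] := ∑ i : Fin (n + 1), C (deriv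
        (fun x => (hankelMatrix (μ x) (n + 1)).adjugate i (Fin.last n)) s) * X ^ (i : ℕ) with hQ
  have hent : ∀ i j : Fin (n + 1), DifferentiableAt ℝ (fun x => hankelMatrix (μ x) (n + 1) i j) s :=
    fun i j => (hμ (i + j)).differentiableAt
  have hadj := fun i => differentiableAt_adjugate hent i (Fin.last n)
  refine linearMap_eq_coeff_mul
    (φ := (hankelMatrix (μ s) n).det •
      (momentFunctional μ' ∘ₗ LinearMap.mulLeft ℝ (orthPoly (μ s) n)) +
      momentFunctional (μ s) ∘ₗ LinearMap.mulLeft ℝ Q)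
    (fun k => ?_) hq
  have h1 : HasDerivAt (fun x => ∑ i : Fin (n + 1), μ x (k + i) *
      (hankelMatrix (μ x) (n + 1)).adjugate i (Fin.last n))
      (∑ i : Fin (n + 1), (μ' (k + i) * (hankelMatrix (μ s) (n + 1)).adjugate i (Fin.last n) +
        μ s (k + i) * deriv (fun x => (hankelMatrix (μ x) (n + 1)).adjugate i (Fin.last n)) s)) s :=
    HasDerivAt.fun_sum fun i _ => (hμ _).mul (hadj i).hasDerivAt
  have h2 : HasDerivAt (fun x => ∑ i : Fin (n + 1), μ x (k + i) *
      (hankelMatrix (μ x) (n + 1)).adjugate i (Fin.last n))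
      (if k = Fin.last n then deriv (fun x => (hankelMatrix (μ x) (n + 1)).det) s else 0) s := by
    simp only [sum_hankelMatrix_mul_adjugate]
    split_ifs
    · exact (differentiableAt_det hent).hasDerivAt
    · exact hasDerivAt_const _ _
  rw [← h1.unique h2, Finset.sum_add_distrib]
  simp only [LinearMap.add_apply, LinearMap.smul_apply, LinearMap.comp_apply,
    LinearMap.mulLeft_apply, smul_eq_mul]
  congr 1
  · rw [orthPoly, Finset.sum_mul, map_sum, Finset.mul_sum]
    refine Finset.sum_congr rfl fun i _ => ?_
    rw [mul_assoc, ← pow_add, momentFunctional_C_mul, momentFunctional_X_pow, add_comm (i : ℕ)]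
    field_simp [hD n]
  · rw [hQ, Finset.sum_mul, map_sum]
    refine Finset.sum_congr rfl fun i _ => ?_
    rw [mul_assoc, ← pow_add, momentFunctional_C_mul, momentFunctional_X_pow, add_comm (i : ℕ)]
    ring

/-- The relation `(log h_n)' = L'(P_n²) / h_n`, cleared of the denominators of
`h_n = D_{n+1} / D_n`. -/
theorem deriv_det_succ {μ : ℝ → ℕ → ℝ} {μ' : ℕ → ℝ} {s : ℝ}
    (hμ : ∀ k, HasDerivAt (fun x => μ x k) (μ' k) s)
    (hD : ∀ n, (hankelMatrix (μ s) n).det ≠ 0) (n : ℕ) :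
    deriv (fun x => (hankelMatrix (μ x) (n + 1)).det) s =
      (hankelMatrix (μ s) n).det * momentFunctional μ' (orthPoly (μ s) n * orthPoly (μ s) n) +
      deriv (fun x => (hankelMatrix (μ x) n).det) s * sqNorm (μ s) n := by
  have h := variation_orthogonality hμ hD n (natDegree_orthPoly_le (μ s) n)
  rw [coeff_orthPoly_self hD, one_mul, mul_comm (Finset.sum _ _),
    momentFunctional_orthPoly_mul _ _ (natDegree_sum_fin_le n _), coeff_sum_fin,
    dif_pos (Nat.lt_succ_self n)] at h
  rw [← h]
  congr 3
  funext x
  exact (adjugate_hankelMatrix_last (μ x) n)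

theorem hasDerivAt_det_hankelMatrix {μ : ℝ → ℕ → ℝ} {μ' : ℕ → ℝ} {s : ℝ}
    (hμ : ∀ k, HasDerivAt (fun x => μ x k) (μ' k) s) (n : ℕ) :
    HasDerivAt (fun x => (hankelMatrix (μ x) n).det)
      (deriv (fun x => (hankelMatrix (μ x) n).det) s) s :=
  (differentiableAt_det fun i j => (hμ (i + j)).differentiableAt).hasDerivAt

theorem hasDerivAt_sqNorm {μ : ℝ → ℕ → ℝ} {μ' : ℕ → ℝ} {s : ℝ}
    (hμ : ∀ k, HasDerivAt (fun x => μ x k) (μ' k) s)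
    (hD : ∀ n, (hankelMatrix (μ s) n).det ≠ 0) (n : ℕ) :
    HasDerivAt (fun x => sqNorm (μ x) n)
      (momentFunctional μ' (orthPoly (μ s) n * orthPoly (μ s) n)) s := by
  have h := (hasDerivAt_det_hankelMatrix hμ (n + 1)).div (hasDerivAt_det_hankelMatrix hμ n) (hD n)
  refine h.congr_deriv ?_
  rw [deriv_det_succ hμ hD, sqNorm]
  field_simp [hD n]
  ring

theorem hasDerivAt_log_det {μ : ℝ → ℕ → ℝ} {μ' : ℕ → ℝ} {s : ℝ}
    (hμ : ∀ k, HasDerivAt (fun x => μ x k) (μ' k) s)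
    (hD : ∀ n, (hankelMatrix (μ s) n).det ≠ 0) (n : ℕ) :
    HasDerivAt (fun x => Real.log (hankelMatrix (μ x) n).det)
      (∑ j ∈ Finset.range n, momentFunctional μ' (orthPoly (μ s) j * orthPoly (μ s) j) /
        sqNorm (μ s) j) s := by
  refine ((hasDerivAt_det_hankelMatrix hμ n).log (hD n)).congr_deriv ?_
  induction n with
  | zero => simp [Matrix.det_fin_zero]
  | succ n ih =>
    rw [Finset.sum_range_succ, ← ih, deriv_det_succ hμ hD, sqNorm]
    have h1 := hD n
    have h2 := hD (n + 1)
    field_simp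
    ring

/-- Variation of the subleading coefficient of `P_{n+1}`. -/
theorem hasDerivAt_subCoeff {μ : ℝ → ℕ → ℝ} {μ' : ℕ → ℝ} {s : ℝ}
    (hμ : ∀ k, HasDerivAt (fun x => μ x k) (μ' k) s)
    (hD : ∀ n, (hankelMatrix (μ s) n).det ≠ 0) (n : ℕ) :
    HasDerivAt (fun x => subCoeff (μ x) (n + 1))
      (-momentFunctional μ' (orthPoly (μ s) (n + 1) * orthPoly (μ s) n) / sqNorm (μ s) n) s := by
  have hent : ∀ i j : Fin (n + 1 + 1),
      DifferentiableAt ℝ (fun x => hankelMatrix (μ x) (n + 1 + 1) i j) s :=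
    fun i j => (hμ (i + j)).differentiableAt
  have hlt : n < n + 1 + 1 := by omega
  have hsub : ∀ x, subCoeff (μ x) (n + 1) = (hankelMatrix (μ x) (n + 1 + 1)).adjugate ⟨n, hlt⟩
      (Fin.last (n + 1)) / (hankelMatrix (μ x) (n + 1)).det := by
    intro x
    rw [subCoeff_succ, orthPoly, coeff_sum_fin, dif_pos hlt]
  have h := variation_orthogonality hμ hD (n + 1)
    ((natDegree_orthPoly_le (μ s) n).trans (Nat.le_succ n))
  set Q : ℝ[X] := ∑ i : Fin (n + 1 + 1), C (deriv
    (fun x => (hankelMatrix (μ x) (n + 1 + 1)).adjugate i (Fin.last (n + 1))) s) * X ^ (i : ℕ)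
    with hQ
  set d := deriv (fun x => (hankelMatrix (μ x) (n + 1)).det) s with hd
  set e := deriv (fun x => (hankelMatrix (μ x) (n + 1 + 1)).adjugate ⟨n, hlt⟩
    (Fin.last (n + 1))) s with he
  have hQn : Q.coeff n = e := by rw [hQ, coeff_sum_fin, dif_pos hlt]
  have hQn1 : Q.coeff (n + 1) = d := by
    rw [hQ, coeff_sum_fin, dif_pos (Nat.lt_succ_self _), hd]
    congr 1
    funext x
    exact adjugate_hankelMatrix_last (μ x) (n + 1)
  have hQd : Q.natDegree ≤ n + 1 := natDegree_sum_fin_le _ _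
  have hPd := natDegree_orthPoly_le (μ s) (n + 1)
  -- `Q` is the derivative of `D_{n+1} P_{n+1}`; modulo `P_{n+1}` it has degree at most `n`, so that
  -- its pairing with `P_n` reads off one coefficient
  have hlow : (Q - C d * orthPoly (μ s) (n + 1)).natDegree ≤ n := by
    rw [natDegree_le_iff_coeff_eq_zero]
    intro k hk
    rw [coeff_sub, coeff_C_mul]
    rcases Nat.lt_or_ge (n + 1) k with h | h
    · rw [coeff_eq_zero_of_natDegree_lt (hQd.trans_lt h),
        coeff_eq_zero_of_natDegree_lt (hPd.trans_lt h), mul_zero, sub_zero]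
    · obtain rfl : k = n + 1 := by omega
      rw [hQn1, coeff_orthPoly_self hD, mul_one, sub_self]
  have hsplit : Q * orthPoly (μ s) n = orthPoly (μ s) n * (Q - C d * orthPoly (μ s) (n + 1)) +
      C d * (orthPoly (μ s) (n + 1) * orthPoly (μ s) n) := by ring
  have hPn := natDegree_orthPoly_le (μ s) n
  rw [hsplit, map_add, momentFunctional_C_mul, momentFunctional_orthPoly_mul _ _ hlow,
    momentFunctional_orthPoly_mul _ _ (hPn.trans (Nat.le_succ n)),
    coeff_eq_zero_of_natDegree_lt (hPn.trans_lt (Nat.lt_succ_self n)), coeff_sub, coeff_C_mul, hQn,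
    ← subCoeff_succ, hsub] at h
  have hder := (differentiableAt_adjugate hent ⟨n, hlt⟩ (Fin.last (n + 1))).hasDerivAt.div
    (hasDerivAt_det_hankelMatrix hμ (n + 1)) (hD (n + 1))
  refine (hder.congr_deriv ?_).congr_of_eventuallyEq (Filter.Eventually.of_forall hsub)
  rw [← hd, ← he]
  have h1 := hD (n + 1)
  have h2 := sqNorm_ne_zero hD n
  field_simp at h ⊢
  linear_combination h

/-! ### Parameter integrals of Laguerre type -/

/-- Powers of a shifted variable are dominated by a slowly growing exponential. -/
theorem exists_add_rpow_le_exp {r : ℝ} (hr : 0 < r) (a : ℝ) :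
    ∃ C : ℝ, 0 ≤ C ∧ ∀ x : ℝ, 0 < x → (r + x) ^ a ≤ C * Real.exp (x / 4) := by
  rcases le_or_gt a 0 with ha | ha
  · refine ⟨r ^ a, by positivity, fun x hx => ?_⟩
    calc (r + x) ^ a ≤ r ^ a := Real.rpow_le_rpow_of_nonpos hr (by linarith) ha
      _ = r ^ a * 1 := (mul_one _).symm
      _ ≤ _ := by
        gcongr
        exact Real.one_le_exp (by positivity)
  · refine ⟨(4 * a) ^ a * Real.exp (r / 4), by positivity, fun x hx => ?_⟩
    have h1 : r + x ≤ 4 * a * Real.exp ((r + x) / (4 * a)) := by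
      have := Real.add_one_le_exp ((r + x) / (4 * a))
      have h2 : (r + x) / (4 * a) ≤ Real.exp ((r + x) / (4 * a)) := by linarith
      rwa [div_le_iff₀' (by positivity)] at h2
    calc (r + x) ^ a ≤ (4 * a * Real.exp ((r + x) / (4 * a))) ^ a :=
          Real.rpow_le_rpow (by positivity) h1 ha.le
      _ = (4 * a) ^ a * Real.exp (r / 4) * Real.exp (x / 4) := by
          rw [Real.mul_rpow (by positivity) (by positivity), ← Real.exp_mul, mul_assoc,
            ← Real.exp_add]
          congr 2
          field_simp

/-- The integrand `x^s e^{-x} (t + x)^a (T + x)^b`. With independent exponents `a`, `b` the family is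
stable under `∂_T` and `∂_t`. -/
def laguerreKernel (s a b T t x : ℝ) : ℝ :=
  x ^ s * Real.exp (-x) * ((t + x) ^ a * (T + x) ^ b)

/-- The integral of `laguerreKernel s a b T t` over `(0, ∞)`; it converges for `s > -1` and
`T, t > 0`. -/
def laguerreIntegral (s a b T t : ℝ) : ℝ :=
  ∫ x in Set.Ioi (0 : ℝ), laguerreKernel s a b T t x

theorem laguerreKernel_pos {T t x : ℝ} (s a b : ℝ) (hT : 0 < T) (ht : 0 < t) (hx : 0 < x) :
    0 < laguerreKernel s a b T t x := by
  unfold laguerreKernel; positivity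

theorem continuousOn_laguerreKernel {T t : ℝ} (s a b : ℝ) (hT : 0 < T) (ht : 0 < t) :
    ContinuousOn (laguerreKernel s a b T t) (Ioi 0) := by
  unfold laguerreKernel
  intro x hx
  rw [mem_Ioi] at hx
  apply ContinuousAt.continuousWithinAt
  have h1 : ContinuousAt (fun x : ℝ => x ^ s) x := Real.continuousAt_rpow_const _ _ (Or.inl hx.ne')
  have h2 : ContinuousAt (fun x : ℝ => (t + x) ^ a) x :=
    ContinuousAt.rpow_const (by fun_prop) (Or.inl (by positivity))
  have h3 : ContinuousAt (fun x : ℝ => (T + x) ^ b) x :=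
    ContinuousAt.rpow_const (by fun_prop) (Or.inl (by positivity))
  fun_prop

theorem aestronglyMeasurable_laguerreKernel {T t : ℝ} (s a b : ℝ) (hT : 0 < T) (ht : 0 < t) :
    AEStronglyMeasurable (laguerreKernel s a b T t) (volume.restrict (Ioi 0)) :=
  (continuousOn_laguerreKernel s a b hT ht).aestronglyMeasurable measurableSet_Ioi

theorem integrableOn_laguerreKernel {s T t : ℝ} (hs : -1 < s) (a b : ℝ) (hT : 0 < T) (ht : 0 < t) :
    IntegrableOn (laguerreKernel s a b T t) (Ioi 0) := by
  obtain ⟨C, hC, hCb⟩ := exists_add_rpow_le_exp ht a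
  obtain ⟨K, hK, hKb⟩ := exists_add_rpow_le_exp hT b
  -- each power costs a factor `e^{x / 4}`, which leaves `x^s e^{-x / 2}`
  have hg : IntegrableOn (fun x : ℝ => x ^ s * Real.exp (-(1 / 2) * x ^ (1 : ℝ))) (Ioi 0) :=
    integrableOn_rpow_mul_exp_neg_mul_rpow hs one_pos (by norm_num)
  refine Integrable.mono' (hg.const_mul (C * K))
    (aestronglyMeasurable_laguerreKernel s a b hT ht) ?_
  refine (ae_restrict_iff' measurableSet_Ioi).mpr (Filter.Eventually.of_forall fun x hx => ?_)
  rw [mem_Ioi] at hx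
  rw [Real.norm_of_nonneg (laguerreKernel_pos s a b hT ht hx).le, laguerreKernel]
  calc x ^ s * Real.exp (-x) * ((t + x) ^ a * (T + x) ^ b)
      ≤ x ^ s * Real.exp (-x) * ((C * Real.exp (x / 4)) * (K * Real.exp (x / 4))) := by
        gcongr
        · exact hCb x hx
        · exact hKb x hx
    _ = C * K * (x ^ s * (Real.exp (-x) * Real.exp (x / 4) * Real.exp (x / 4))) := by ring
    _ = _ := by
        rw [← Real.exp_add, ← Real.exp_add, Real.rpow_one]
        ring_nf

/-- A power on an interval is bounded by the sum of its values at the end points, whatever the sign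
of the exponent. -/
theorem rpow_le_add_rpow {l u y : ℝ} (hl : 0 < l) (hly : l ≤ y) (hyu : y ≤ u) (a : ℝ) :
    y ^ a ≤ l ^ a + u ^ a := by
  have hy : 0 < y := hl.trans_le hly
  have hu : 0 < u := hy.trans_le hyu
  rcases le_total a 0 with ha | ha
  · exact (Real.rpow_le_rpow_of_nonpos hl hly ha).trans
      (le_add_of_nonneg_right (by positivity))
  · exact (Real.rpow_le_rpow hy.le hyu ha).trans (le_add_of_nonneg_left (by positivity))

/-- An integrable bound for `laguerreKernel s a b T' t'`, uniform over `T / 2 < T' < 2 T` and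
`t / 2 < t' < 2 t`. -/
def laguerreMajorant (s a b T t x : ℝ) : ℝ :=
  laguerreKernel s a b (T / 2) (t / 2) x + laguerreKernel s a b (T / 2) (2 * t) x +
    (laguerreKernel s a b (2 * T) (t / 2) x + laguerreKernel s a b (2 * T) (2 * t) x)

theorem integrableOn_laguerreMajorant {s T t : ℝ} (hs : -1 < s) (a b : ℝ) (hT : 0 < T)
    (ht : 0 < t) : IntegrableOn (laguerreMajorant s a b T t) (Ioi 0) := by
  have h := fun {T t} => integrableOn_laguerreKernel (T := T) (t := t) hs a b
  exact ((h (by positivity) (by positivity)).add (h (by positivity) (by positivity))).add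
    ((h (by positivity) (by positivity)).add (h (by positivity) (by positivity)))

theorem laguerreKernel_le_majorant {T t x T' t' : ℝ} (s a b : ℝ) (hT : 0 < T) (ht : 0 < t)
    (hT' : T' ∈ Ioo (T / 2) (2 * T)) (ht' : t' ∈ Ioo (t / 2) (2 * t)) (hx : 0 < x) :
    laguerreKernel s a b T' t' x ≤ laguerreMajorant s a b T t x := by
  have h1 := rpow_le_add_rpow (l := t / 2 + x) (u := 2 * t + x) (y := t' + x) (by positivity)
    (by linarith [ht'.1]) (by linarith [ht'.2]) a
  have h2 := rpow_le_add_rpow (l := T / 2 + x) (u := 2 * T + x) (y := T' + x) (by positivity)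
    (by linarith [hT'.1]) (by linarith [hT'.2]) b
  have hT0 : 0 < T' := lt_trans (by positivity) hT'.1
  have ht0 : 0 < t' := lt_trans (by positivity) ht'.1
  calc laguerreKernel s a b T' t' x
      ≤ x ^ s * Real.exp (-x) * (((t / 2 + x) ^ a + (2 * t + x) ^ a) *
        ((T / 2 + x) ^ b + (2 * T + x) ^ b)) := by
        unfold laguerreKernel
        gcongr
    _ = _ := by unfold laguerreMajorant laguerreKernel; ring

theorem hasFDerivAt_laguerreKernel {x : ℝ} (s a b : ℝ) (hx : 0 < x) {p : ℝ × ℝ} (hp1 : 0 < p.1)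
    (hp2 : 0 < p.2) :
    HasFDerivAt (fun p : ℝ × ℝ => laguerreKernel s a b p.1 p.2 x)
      ((b * laguerreKernel s a (b - 1) p.1 p.2 x) • ContinuousLinearMap.fst ℝ ℝ ℝ +
        (a * laguerreKernel s (a - 1) b p.1 p.2 x) • ContinuousLinearMap.snd ℝ ℝ ℝ) p := by
  have h1 : HasFDerivAt (fun p : ℝ × ℝ => (p.1 + x) ^ b)
      ((b * (p.1 + x) ^ (b - 1)) • ContinuousLinearMap.fst ℝ ℝ ℝ) p :=
    ((hasFDerivAt_fst (𝕜 := ℝ) (p := p)).add_const x).rpow_const (Or.inl (by positivity))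
  have h2 : HasFDerivAt (fun p : ℝ × ℝ => (p.2 + x) ^ a)
      ((a * (p.2 + x) ^ (a - 1)) • ContinuousLinearMap.snd ℝ ℝ ℝ) p :=
    ((hasFDerivAt_snd (𝕜 := ℝ) (p := p)).add_const x).rpow_const (Or.inl (by positivity))
  refine ((h2.mul h1).const_mul (x ^ s * Real.exp (-x))).congr_fderiv ?_
  ext <;> simp [laguerreKernel] <;> ring

theorem hasFDerivAt_laguerreIntegral {s : ℝ} (hs : -1 < s) (a b : ℝ) {p : ℝ × ℝ} (hp1 : 0 < p.1)
    (hp2 : 0 < p.2) :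
    HasFDerivAt (fun p : ℝ × ℝ => laguerreIntegral s a b p.1 p.2)
      ((b * laguerreIntegral s a (b - 1) p.1 p.2) • ContinuousLinearMap.fst ℝ ℝ ℝ +
        (a * laguerreIntegral s (a - 1) b p.1 p.2) • ContinuousLinearMap.snd ℝ ℝ ℝ) p := by
  have hnhds : Ioo (p.1 / 2) (2 * p.1) ×ˢ Ioo (p.2 / 2) (2 * p.2) ∈ nhds p :=
    prod_mem_nhds (Ioo_mem_nhds (by linarith) (by linarith))
      (Ioo_mem_nhds (by linarith) (by linarith))
  have i1 := (integrableOn_laguerreKernel hs a (b - 1) hp1 hp2).const_mul b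
  have i2 := (integrableOn_laguerreKernel hs (a - 1) b hp1 hp2).const_mul a
  have hI1 := i1.smul_const (ContinuousLinearMap.fst ℝ ℝ ℝ)
  have hI2 := i2.smul_const (ContinuousLinearMap.snd ℝ ℝ ℝ)
  have h := hasFDerivAt_integral_of_dominated_of_fderiv_le (𝕜 := ℝ)
    (μ := volume.restrict (Ioi (0 : ℝ)))
    (F := fun (p : ℝ × ℝ) x => laguerreKernel s a b p.1 p.2 x)
    (F' := fun (p : ℝ × ℝ) x =>
      (b * laguerreKernel s a (b - 1) p.1 p.2 x) • ContinuousLinearMap.fst ℝ ℝ ℝ +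
        (a * laguerreKernel s (a - 1) b p.1 p.2 x) • ContinuousLinearMap.snd ℝ ℝ ℝ)
    (bound := fun x => |b| * laguerreMajorant s a (b - 1) p.1 p.2 x +
      |a| * laguerreMajorant s (a - 1) b p.1 p.2 x)
    (x₀ := p) hnhds ?_ (integrableOn_laguerreKernel hs a b hp1 hp2) (hI1.add hI2).1 ?_ ?_ ?_
  · refine h.congr_fderiv ?_
    rw [integral_add hI1 hI2, integral_smul_const, integral_smul_const, integral_const_mul,
      integral_const_mul]
    rfl
  · filter_upwards [hnhds] with q hq
    exact aestronglyMeasurable_laguerreKernel s a b (lt_trans (by positivity) hq.1.1)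
      (lt_trans (by positivity) hq.2.1)
  · refine (ae_restrict_iff' measurableSet_Ioi).mpr (Filter.Eventually.of_forall fun x hx q hq => ?_)
    have hq1 : 0 < q.1 := lt_trans (by positivity) hq.1.1
    have hq2 : 0 < q.2 := lt_trans (by positivity) hq.2.1
    refine (norm_add_le _ _).trans (add_le_add ?_ ?_)
    · rw [norm_smul, norm_mul, Real.norm_eq_abs,
        Real.norm_of_nonneg (laguerreKernel_pos _ _ _ hq1 hq2 hx).le]
      refine (mul_le_of_le_one_right (mul_nonneg (abs_nonneg _)
        (laguerreKernel_pos _ _ _ hq1 hq2 hx).le) (ContinuousLinearMap.norm_fst_le ℝ ℝ ℝ)).trans ?_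
      gcongr
      exact laguerreKernel_le_majorant _ _ _ hp1 hp2 hq.1 hq.2 hx
    · rw [norm_smul, norm_mul, Real.norm_eq_abs,
        Real.norm_of_nonneg (laguerreKernel_pos _ _ _ hq1 hq2 hx).le]
      refine (mul_le_of_le_one_right (mul_nonneg (abs_nonneg _)
        (laguerreKernel_pos _ _ _ hq1 hq2 hx).le) (ContinuousLinearMap.norm_snd_le ℝ ℝ ℝ)).trans ?_
      gcongr
      exact laguerreKernel_le_majorant _ _ _ hp1 hp2 hq.1 hq.2 hx
  · exact ((integrableOn_laguerreMajorant hs _ _ hp1 hp2).const_mul _).add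
      ((integrableOn_laguerreMajorant hs _ _ hp1 hp2).const_mul _)
  · refine (ae_restrict_iff' measurableSet_Ioi).mpr (Filter.Eventually.of_forall fun x hx q hq => ?_)
    exact hasFDerivAt_laguerreKernel s a b hx (lt_trans (by positivity) hq.1.1)
      (lt_trans (by positivity) hq.2.1)

theorem contDiffOn_laguerreIntegral {s : ℝ} (hs : -1 < s) (m : ℕ) (a b : ℝ) :
    ContDiffOn ℝ m (fun p : ℝ × ℝ => laguerreIntegral s a b p.1 p.2) (Ioi 0 ×ˢ Ioi 0) := by
  induction m generalizing a b with
  | zero =>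
    rw [Nat.cast_zero, contDiffOn_zero]
    exact fun p hp =>
      (hasFDerivAt_laguerreIntegral hs a b hp.1 hp.2).continuousAt.continuousWithinAt
  | succ m ih =>
    rw [Nat.cast_succ, contDiffOn_succ_iff_fderiv_of_isOpen (isOpen_Ioi.prod isOpen_Ioi)]
    refine ⟨fun p hp => (hasFDerivAt_laguerreIntegral hs a b hp.1
      hp.2).differentiableAt.differentiableWithinAt, by simp, ?_⟩
    have h : ContDiffOn ℝ m (fun p : ℝ × ℝ =>
        (b * laguerreIntegral s a (b - 1) p.1 p.2) • ContinuousLinearMap.fst ℝ ℝ ℝ +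
        (a * laguerreIntegral s (a - 1) b p.1 p.2) • ContinuousLinearMap.snd ℝ ℝ ℝ)
        (Ioi 0 ×ˢ Ioi 0) :=
      ((contDiffOn_const.mul (ih a (b - 1))).smul contDiffOn_const).add
        ((contDiffOn_const.mul (ih (a - 1) b)).smul contDiffOn_const)
    exact h.congr fun p hp => (hasFDerivAt_laguerreIntegral hs a b hp.1 hp.2).fderiv

theorem hasDerivAt_laguerreIntegral_fst {s : ℝ} (hs : -1 < s) (a b : ℝ) {T t : ℝ} (hT : 0 < T)
    (ht : 0 < t) :
    HasDerivAt (fun T => laguerreIntegral s a b T t) (b * laguerreIntegral s a (b - 1) T t) T := by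
  have h := (hasFDerivAt_laguerreIntegral hs a b (p := (T, t)) hT ht).comp_hasDerivAt T
    ((hasDerivAt_id T).prodMk (hasDerivAt_const T t))
  simpa [Function.comp_def] using h

theorem hasDerivAt_laguerreIntegral_snd {s : ℝ} (hs : -1 < s) (a b : ℝ) {T t : ℝ} (hT : 0 < T)
    (ht : 0 < t) :
    HasDerivAt (fun t => laguerreIntegral s a b T t) (a * laguerreIntegral s (a - 1) b T t) t := by
  have h := (hasFDerivAt_laguerreIntegral hs a b (p := (T, t)) hT ht).comp_hasDerivAt t
    ((hasDerivAt_const t T).prodMk (hasDerivAt_id t))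
  simpa [Function.comp_def] using h

theorem laguerreKernel_succ_fst {T t x : ℝ} (s a b : ℝ) (ht : 0 < t) (hx : 0 < x) :
    laguerreKernel (s + 1) (a - 1) b T t x + t * laguerreKernel s (a - 1) b T t x =
      laguerreKernel s a b T t x := by
  have h1 : (t + x) ^ a = (t + x) ^ (a - 1) * (t + x) := by
    rw [← Real.rpow_add_one (by positivity)]; ring_nf
  rw [laguerreKernel, laguerreKernel, laguerreKernel, Real.rpow_add_one hx.ne', h1]
  ring

theorem laguerreKernel_succ_snd {T t x : ℝ} (s a b : ℝ) (hT : 0 < T) (hx : 0 < x) :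
    laguerreKernel (s + 1) a (b - 1) T t x + T * laguerreKernel s a (b - 1) T t x =
      laguerreKernel s a b T t x := by
  have h1 : (T + x) ^ b = (T + x) ^ (b - 1) * (T + x) := by
    rw [← Real.rpow_add_one (by positivity)]; ring_nf
  rw [laguerreKernel, laguerreKernel, laguerreKernel, Real.rpow_add_one hx.ne', h1]
  ring

theorem laguerreIntegral_succ_fst {s T t : ℝ} (hs : -1 < s) (a b : ℝ) (hT : 0 < T) (ht : 0 < t) :
    laguerreIntegral (s + 1) (a - 1) b T t + t * laguerreIntegral s (a - 1) b T t =
      laguerreIntegral s a b T t := by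
  have i1 := integrableOn_laguerreKernel (s := s + 1) (by linarith) (a - 1) b hT ht
  have i2 := (integrableOn_laguerreKernel hs (a - 1) b hT ht).const_mul t
  rw [laguerreIntegral, laguerreIntegral, laguerreIntegral, ← integral_const_mul,
    ← integral_add i1 i2]
  exact setIntegral_congr_fun measurableSet_Ioi fun x hx => laguerreKernel_succ_fst s a b ht hx

theorem laguerreIntegral_succ_snd {s T t : ℝ} (hs : -1 < s) (a b : ℝ) (hT : 0 < T) (ht : 0 < t) :
    laguerreIntegral (s + 1) a (b - 1) T t + T * laguerreIntegral s a (b - 1) T t =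
      laguerreIntegral s a b T t := by
  have i1 := integrableOn_laguerreKernel (s := s + 1) (by linarith) a (b - 1) hT ht
  have i2 := (integrableOn_laguerreKernel hs a (b - 1) hT ht).const_mul T
  rw [laguerreIntegral, laguerreIntegral, laguerreIntegral, ← integral_const_mul,
    ← integral_add i1 i2]
  exact setIntegral_congr_fun measurableSet_Ioi fun x hx => laguerreKernel_succ_snd s a b hT hx

/-- Integration by parts: the integral of the derivative of `laguerreKernel (s + 1) a b T t`
vanishes, the boundary term at `0` because `s + 1 > 0`. -/
theorem laguerreIntegral_byParts {s T t : ℝ} (hs : -1 < s) (a b : ℝ) (hT : 0 < T) (ht : 0 < t) :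
    (s + 1) * laguerreIntegral s a b T t - laguerreIntegral (s + 1) a b T t +
      a * laguerreIntegral (s + 1) (a - 1) b T t + b * laguerreIntegral (s + 1) a (b - 1) T t = 0 := by
  have hs1 : -1 < s + 1 := by linarith
  have i1 := (integrableOn_laguerreKernel hs a b hT ht).const_mul (s + 1)
  have i2 := integrableOn_laguerreKernel hs1 a b hT ht
  have i3 := (integrableOn_laguerreKernel hs1 (a - 1) b hT ht).const_mul a
  have i4 := (integrableOn_laguerreKernel hs1 a (b - 1) hT ht).const_mul b
  have hd : ∀ x ∈ Ioi (0 : ℝ), HasDerivAt (laguerreKernel (s + 1) a b T t)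
      ((s + 1) * laguerreKernel s a b T t x - laguerreKernel (s + 1) a b T t x +
        a * laguerreKernel (s + 1) (a - 1) b T t x + b * laguerreKernel (s + 1) a (b - 1) T t x)
      x := by
    intro x hx
    rw [mem_Ioi] at hx
    have h1 : HasDerivAt (fun x : ℝ => x ^ (s + 1)) ((s + 1) * x ^ s) x := by
      have := Real.hasDerivAt_rpow_const (x := x) (p := s + 1) (Or.inl hx.ne')
      rwa [add_sub_cancel_right] at this
    have h2 : HasDerivAt (fun x : ℝ => Real.exp (-x)) (Real.exp (-x) * (-1)) x :=
      (hasDerivAt_id x).neg.exp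
    have h3 : HasDerivAt (fun x : ℝ => (t + x) ^ a) (1 * a * (t + x) ^ (a - 1)) x :=
      ((hasDerivAt_id x).const_add t).rpow_const (Or.inl (by simp only [id]; positivity))
    have h4 : HasDerivAt (fun x : ℝ => (T + x) ^ b) (1 * b * (T + x) ^ (b - 1)) x :=
      ((hasDerivAt_id x).const_add T).rpow_const (Or.inl (by simp only [id]; positivity))
    refine ((h1.mul h2).mul (h3.mul h4)).congr_deriv ?_
    simp only [laguerreKernel, Pi.mul_apply]
    ring
  have hd_int := ((i1.sub i2).add i3).add i4
  have hcont : ContinuousWithinAt (laguerreKernel (s + 1) a b T t) (Ici 0) 0 := by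
    apply ContinuousAt.continuousWithinAt
    unfold laguerreKernel
    have h1 : ContinuousAt (fun x : ℝ => x ^ (s + 1)) 0 :=
      Real.continuousAt_rpow_const _ _ (Or.inr (by linarith))
    have h2 : ContinuousAt (fun x : ℝ => (t + x) ^ a) 0 :=
      ContinuousAt.rpow_const (by fun_prop) (Or.inl (by simpa using ht.ne'))
    have h3 : ContinuousAt (fun x : ℝ => (T + x) ^ b) 0 :=
      ContinuousAt.rpow_const (by fun_prop) (Or.inl (by simpa using hT.ne'))
    fun_prop
  have h := integral_Ioi_of_hasDerivAt_of_tendsto hcont hd hd_int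
    (tendsto_zero_of_hasDerivAt_of_integrableOn_Ioi hd hd_int i2)
  have h0 : laguerreKernel (s + 1) a b T t 0 = 0 := by
    rw [laguerreKernel, Real.zero_rpow (by linarith)]; ring
  have e1 := integral_sub i1 i2
  have e2 := integral_add (i1.sub i2) i3
  have e3 := integral_add ((i1.sub i2).add i3) i4
  simp only [Pi.add_apply, Pi.sub_apply] at e1 e2 e3
  rw [h0, sub_zero, e3, e2, e1, integral_const_mul, integral_const_mul, integral_const_mul] at h
  exact h

/-! ### Heine's identity and positivity of Hankel determinants -/

/-- Heine's identity: the multiple integral of the squared Vandermonde product is the Hankel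
determinant of the moments. -/
theorem multipleIntegral_eq_hankelDet {w : ℝ → ℝ}
    (hw : ∀ k : ℕ, IntegrableOn (fun x => x ^ k * w x) (Ici 0)) (n : ℕ) :
    multipleIntegral n w = hankelDet n w := by
  have hpt : ∀ x : Fin n → ℝ, (∏ i : Fin n, ∏ j ∈ Finset.Ioi i, (x j - x i) ^ 2) * ∏ k, w (x k) =
      ∑ σ : Equiv.Perm (Fin n), ∑ τ : Equiv.Perm (Fin n),
        ((Equiv.Perm.sign σ : ℤ) : ℝ) * ((Equiv.Perm.sign τ : ℤ) : ℝ) *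
          ∏ i, (x i ^ ((σ i : ℕ) + (τ i : ℕ)) * w (x i)) := by
    intro x
    have hdet : ∏ i : Fin n, ∏ j ∈ Finset.Ioi i, (x j - x i) =
        ∑ σ : Equiv.Perm (Fin n), ((Equiv.Perm.sign σ : ℤ) : ℝ) * ∏ i, x i ^ (σ i : ℕ) := by
      rw [← Matrix.det_vandermonde, ← Matrix.det_transpose, Matrix.det_apply']
      simp [Matrix.vandermonde_apply]
    simp only [Finset.prod_pow]
    rw [hdet, sq, Finset.sum_mul_sum, Finset.sum_mul]
    refine Finset.sum_congr rfl fun σ _ => ?_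
    rw [Finset.sum_mul]
    refine Finset.sum_congr rfl fun τ _ => ?_
    simp only [Finset.prod_mul_distrib, pow_add]
    ring
  have hint : ∀ σ τ : Equiv.Perm (Fin n), Integrable (fun x : Fin n → ℝ =>
      ∏ i, (x i ^ ((σ i : ℕ) + (τ i : ℕ)) * w (x i)))
      (Measure.pi fun _ : Fin n => (volume : Measure ℝ).restrict (Ici 0)) := fun σ τ =>
    Integrable.fintype_prod (f := fun (i : Fin n) (y : ℝ) => y ^ ((σ i : ℕ) + (τ i : ℕ)) * w y)
      fun i => hw _
  have hval : ∀ σ τ : Equiv.Perm (Fin n), ∫ x : Fin n → ℝ,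
      ∏ i, (x i ^ ((σ i : ℕ) + (τ i : ℕ)) * w (x i))
      ∂(Measure.pi fun _ : Fin n => (volume : Measure ℝ).restrict (Ici 0)) =
      ∏ i, moment w ((σ i : ℕ) + (τ i : ℕ)) := fun σ τ =>
    integral_fintype_prod_eq_prod
      (fun (i : Fin n) (y : ℝ) => y ^ ((σ i : ℕ) + (τ i : ℕ)) * w y)
  -- for fixed `τ` the sum over `σ` is a determinant with columns permuted by `τ`
  have hsum : ∀ τ : Equiv.Perm (Fin n), ∑ σ : Equiv.Perm (Fin n),
      ((Equiv.Perm.sign σ : ℤ) : ℝ) * ((Equiv.Perm.sign τ : ℤ) : ℝ) *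
        ∏ i, moment w ((σ i : ℕ) + (τ i : ℕ)) = hankelDet n w := by
    intro τ
    have h := Matrix.det_permute' τ
      (Matrix.of fun i j : Fin n => moment w ((i : ℕ) + (j : ℕ)))
    rw [Matrix.det_apply'] at h
    have hs : ((Equiv.Perm.sign τ : ℤ) : ℝ) * ((Equiv.Perm.sign τ : ℤ) : ℝ) = 1 := by
      rw [← Int.cast_mul, ← Units.val_mul, Int.units_mul_self]; simp
    calc _ = ((Equiv.Perm.sign τ : ℤ) : ℝ) * ∑ σ : Equiv.Perm (Fin n),
          ((Equiv.Perm.sign σ : ℤ) : ℝ) * ∏ i, ((Matrix.of fun i j : Fin n =>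
            moment w ((i : ℕ) + (j : ℕ))).submatrix id τ) (σ i) i := by
          rw [Finset.mul_sum]
          refine Finset.sum_congr rfl fun σ _ => ?_
          simp only [Matrix.submatrix_apply, Matrix.of_apply, id]
          ring
      _ = _ := by rw [h, ← mul_assoc, hs, one_mul]; rfl
  rw [multipleIntegral, volume_pi, Measure.restrict_pi_pi]
  simp only [hpt]
  rw [integral_finsetSum _ fun σ _ => integrable_finsetSum _ fun τ _ => (hint σ τ).const_mul _]
  have : ∀ σ : Equiv.Perm (Fin n), ∫ x : Fin n → ℝ, ∑ τ : Equiv.Perm (Fin n),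
        ((Equiv.Perm.sign σ : ℤ) : ℝ) * ((Equiv.Perm.sign τ : ℤ) : ℝ) *
          ∏ i, (x i ^ ((σ i : ℕ) + (τ i : ℕ)) * w (x i))
        ∂(Measure.pi fun _ : Fin n => (volume : Measure ℝ).restrict (Ici 0)) =
      ∑ τ : Equiv.Perm (Fin n), ((Equiv.Perm.sign σ : ℤ) : ℝ) * ((Equiv.Perm.sign τ : ℤ) : ℝ) *
        ∏ i, moment w ((σ i : ℕ) + (τ i : ℕ)) := by
    intro σ
    rw [integral_finsetSum _ fun τ _ => (hint σ τ).const_mul _]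
    simp only [integral_const_mul, hval]
  simp only [this]
  rw [Finset.sum_comm]
  simp only [hsum, Finset.sum_const, Finset.card_univ, Fintype.card_perm, Fintype.card_fin,
    nsmul_eq_mul]
  field_simp

/-- The Hankel matrix of a weight that is positive on `(0, ∞)` is a positive definite Gram
matrix. -/
theorem hankelDet_pos {w : ℝ → ℝ}
    (hw : ∀ k : ℕ, IntegrableOn (fun x => x ^ k * w x) (Ici 0)) (hpos : ∀ x, 0 < x → 0 < w x)
    (n : ℕ) : 0 < hankelDet n w := by
  refine Matrix.PosDef.det_pos (Matrix.posDef_iff_dotProduct_mulVec.mpr ⟨?_, fun c hc => ?_⟩)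
  · ext i j
    simp [add_comm]
  · have hpt : ∀ x : ℝ, (∑ i : Fin n, c i * x ^ (i : ℕ)) ^ 2 * w x =
        ∑ i : Fin n, ∑ j : Fin n, c i * c j * (x ^ ((i : ℕ) + (j : ℕ)) * w x) := by
      intro x
      rw [sq, Finset.sum_mul_sum, Finset.sum_mul]
      refine Finset.sum_congr rfl fun i _ => ?_
      rw [Finset.sum_mul]
      refine Finset.sum_congr rfl fun j _ => ?_
      rw [pow_add]; ring
    have hquad : star c ⬝ᵥ ((Matrix.of fun i j : Fin n => moment w ((i : ℕ) + (j : ℕ))).mulVec c) =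
        ∫ x in Ici (0 : ℝ), (∑ i : Fin n, c i * x ^ (i : ℕ)) ^ 2 * w x := by
      simp only [hpt]
      rw [integral_finsetSum _ fun i _ => integrable_finsetSum _ fun j _ => (hw _).const_mul _]
      simp only [dotProduct, Matrix.mulVec, Finset.mul_sum]
      refine Finset.sum_congr rfl fun i _ => ?_
      rw [integral_finsetSum _ fun j _ => (hw _).const_mul _]
      refine Finset.sum_congr rfl fun j _ => ?_
      rw [integral_const_mul]
      simp only [star_trivial, Matrix.of_apply, moment]
      ring
    rw [hquad, integral_Ici_eq_integral_Ioi, setIntegral_pos_iff_support_of_nonneg_ae]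
    · set p : Polynomial ℝ := ∑ i : Fin n, Polynomial.C (c i) * Polynomial.X ^ (i : ℕ) with hp
      have hp0 : p ≠ 0 := by
        intro h0
        apply hc
        funext i
        have h1 : p.coeff i = c i := by
          rw [hp, Polynomial.finsetSum_coeff, Finset.sum_eq_single i]
          · simp
          · intro j _ hj
            rw [Polynomial.coeff_C_mul_X_pow, if_neg]
            exact fun h => hj (Fin.ext h.symm)
          · simp
        rw [← h1, h0]; simp
      have heval : ∀ x : ℝ, ∑ i : Fin n, c i * x ^ (i : ℕ) = p.eval x := by
        intro x
        simp [hp, Polynomial.eval_finsetSum]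
      have hsub : Ioi (0 : ℝ) \ (p.roots.toFinset : Set ℝ) ⊆
          Function.support (fun x => (∑ i : Fin n, c i * x ^ (i : ℕ)) ^ 2 * w x) ∩ Ioi 0 := by
        rintro x ⟨hx, hxr⟩
        refine ⟨?_, hx⟩
        simp only [Finset.mem_coe, Multiset.mem_toFinset, Polynomial.mem_roots hp0,
          Polynomial.IsRoot.def] at hxr
        simp only [Function.mem_support, heval]
        exact mul_ne_zero (pow_ne_zero 2 hxr) (hpos x hx).ne'
      refine lt_of_lt_of_le ?_ (measure_mono hsub)
      rw [measure_sdiff_null ((Finset.finite_toSet _).measure_zero _)]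
      simp
    · exact (ae_restrict_iff' measurableSet_Ioi).mpr (Filter.Eventually.of_forall fun x hx =>
        mul_nonneg (sq_nonneg _) (hpos x hx).le)
    · simp only [hpt]
      exact integrable_finsetSum _ fun i _ => integrable_finsetSum _ fun j _ =>
        ((hw _).mono_set Ioi_subset_Ici_self).const_mul _

/-! ### Moments of the two-time weight -/

/-- The moments of the two-time weight `w`, for `T, t > 0`. -/
def twoTimeMoment (α N T t : ℝ) (k : ℕ) : ℝ := laguerreIntegral (k + α) N (-N) T t

/-- The moments of `w / (x + T)`. -/
def twoTimeMomentT (α N T t : ℝ) (k : ℕ) : ℝ := laguerreIntegral (k + α) N (-N - 1) T t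

/-- The moments of `w / (x + t)`. -/
def twoTimeMomentt (α N T t : ℝ) (k : ℕ) : ℝ := laguerreIntegral (k + α) (N - 1) (-N) T t

theorem neg_one_lt_natCast_add {α : ℝ} (hα : -1 < α) (k : ℕ) : -1 < (k : ℝ) + α := by
  have : (0 : ℝ) ≤ k := Nat.cast_nonneg k
  linarith

theorem pow_mul_weightAF {α N T t x : ℝ} (hT : 0 < T) (ht : 0 < t) (hx : 0 < x) (k : ℕ) :
    x ^ k * weightAF α N T t x = laguerreKernel (k + α) N (-N) T t x := by
  rw [weightAF, laguerreKernel, Real.rpow_add hx, Real.rpow_natCast,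
    Real.div_rpow (by positivity) (by positivity), Real.rpow_neg (by positivity)]
  ring

theorem integrableOn_pow_mul_weightAF {α N T t : ℝ} (hα : -1 < α) (hT : 0 < T) (ht : 0 < t)
    (k : ℕ) : IntegrableOn (fun x => x ^ k * weightAF α N T t x) (Ici 0) := by
  rw [integrableOn_Ici_iff_integrableOn_Ioi]
  exact (integrableOn_laguerreKernel (neg_one_lt_natCast_add hα k) N (-N) hT ht).congr_fun
    (fun x hx => (pow_mul_weightAF hT ht hx k).symm) measurableSet_Ioi

theorem moment_weightAF {α N T t : ℝ} (hT : 0 < T) (ht : 0 < t) (k : ℕ) :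
    moment (weightAF α N T t) k = twoTimeMoment α N T t k := by
  rw [moment, integral_Ici_eq_integral_Ioi, twoTimeMoment, laguerreIntegral]
  exact setIntegral_congr_fun measurableSet_Ioi fun x hx => pow_mul_weightAF hT ht hx k

theorem hankelD_eq_det {α N T t : ℝ} (hT : 0 < T) (ht : 0 < t) (n : ℕ) :
    hankelD n α N T t = (hankelMatrix (twoTimeMoment α N T t) n).det := by
  rw [hankelD, hankelDet, hankelMatrix]
  simp only [moment_weightAF hT ht]

theorem hankelD_pos {α N T t : ℝ} (hα : -1 < α) (hT : 0 < T) (ht : 0 < t) (n : ℕ) :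
    0 < hankelD n α N T t :=
  hankelDet_pos (integrableOn_pow_mul_weightAF hα hT ht)
    (fun x hx => by unfold weightAF; positivity) n

theorem det_twoTimeMoment_pos {α N T t : ℝ} (hα : -1 < α) (hT : 0 < T) (ht : 0 < t) (n : ℕ) :
    0 < (hankelMatrix (twoTimeMoment α N T t) n).det :=
  hankelD_eq_det (N := N) hT ht n ▸ hankelD_pos hα hT ht n

theorem sqNorm_twoTimeMoment_pos {α N T t : ℝ} (hα : -1 < α) (hT : 0 < T) (ht : 0 < t) (n : ℕ) :
    0 < sqNorm (twoTimeMoment α N T t) n :=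
  div_pos (det_twoTimeMoment_pos hα hT ht _) (det_twoTimeMoment_pos hα hT ht _)

theorem isTwoTimeLaguerre {α N T t : ℝ} (hα : -1 < α) (hT : 0 < T) (ht : 0 < t) :
    IsTwoTimeLaguerre α N T t (twoTimeMoment α N T t) (twoTimeMomentT α N T t)
      (twoTimeMomentt α N T t) where
  det_ne_zero n := (det_twoTimeMoment_pos hα hT ht n).ne'
  succ_T k := by
    have := laguerreIntegral_succ_snd (neg_one_lt_natCast_add hα k) N (-N) hT ht
    rw [add_right_comm] at this
    simpa [twoTimeMoment, twoTimeMomentT] using this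
  succ_t k := by
    have := laguerreIntegral_succ_fst (neg_one_lt_natCast_add hα k) N (-N) hT ht
    rw [add_right_comm] at this
    simpa [twoTimeMoment, twoTimeMomentt] using this
  pearson k := by
    have h := laguerreIntegral_byParts (neg_one_lt_natCast_add hα k) N (-N) hT ht
    have h1 := laguerreIntegral_succ_snd (neg_one_lt_natCast_add hα k) N (-N) hT ht
    have h2 := laguerreIntegral_succ_fst (neg_one_lt_natCast_add hα k) N (-N) hT ht
    have e : ((k + 1 : ℕ) : ℝ) + α = k + α + 1 := by push_cast; ring
    rw [twoTimeMoment, twoTimeMoment, twoTimeMomentt, twoTimeMomentT, e]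
    linear_combination h + N * h1 - N * h2

theorem hasDerivAt_twoTimeMoment_fst {α N T t : ℝ} (hα : -1 < α) (hT : 0 < T) (ht : 0 < t)
    (k : ℕ) : HasDerivAt (fun x => twoTimeMoment α N x t k) (-N * twoTimeMomentT α N T t k) T :=
  hasDerivAt_laguerreIntegral_fst (neg_one_lt_natCast_add hα k) N (-N) hT ht

theorem hasDerivAt_twoTimeMoment_snd {α N T t : ℝ} (hα : -1 < α) (hT : 0 < T) (ht : 0 < t)
    (k : ℕ) : HasDerivAt (fun y => twoTimeMoment α N T y k) (N * twoTimeMomentt α N T t k) t :=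
  hasDerivAt_laguerreIntegral_snd (neg_one_lt_natCast_add hα k) N (-N) hT ht

theorem momentFunctional_const_mul (c : ℝ) (μ : ℕ → ℝ) (f : ℝ[X]) :
    momentFunctional (fun k => c * μ k) f = c * momentFunctional μ f :=
  linearMap_eq_of_X_pow (φ := momentFunctional (fun k => c * μ k)) (ψ := c • momentFunctional μ)
    (fun k => by simp [momentFunctional_X_pow]) f

theorem momentFunctional_sq_nonneg {α T t : ℝ} (hα : -1 < α) (a b : ℝ) (hT : 0 < T) (ht : 0 < t)
    (f : ℝ[X]) : 0 ≤ momentFunctional (fun k => laguerreIntegral (k + α) a b T t) (f * f) := by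
  have hker : ∀ (k : ℕ) (x : ℝ), 0 < x →
      laguerreKernel (k + α) a b T t x = x ^ k * laguerreKernel α a b T t x := by
    intro k x hx
    rw [laguerreKernel, laguerreKernel, Real.rpow_add hx, Real.rpow_natCast]
    ring
  have key : ∀ g : ℝ[X], momentFunctional (fun k => laguerreIntegral (k + α) a b T t) g =
      ∫ x in Ioi (0 : ℝ), g.eval x * laguerreKernel α a b T t x := by
    intro g
    have h1 : ∀ x ∈ Ioi (0 : ℝ), g.eval x * laguerreKernel α a b T t x =
        ∑ k ∈ Finset.range (g.natDegree + 1), g.coeff k * laguerreKernel (k + α) a b T t x := by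
      intro x hx
      rw [eval_eq_sum_range, Finset.sum_mul]
      refine Finset.sum_congr rfl fun k _ => ?_
      rw [hker k x hx]
      ring
    rw [setIntegral_congr_fun measurableSet_Ioi h1, integral_finsetSum _ fun k _ =>
      (integrableOn_laguerreKernel (neg_one_lt_natCast_add hα k) a b hT ht).const_mul _]
    conv_lhs => rw [g.as_sum_range_C_mul_X_pow]
    rw [map_sum]
    refine Finset.sum_congr rfl fun k _ => ?_
    rw [momentFunctional_C_mul, momentFunctional_X_pow, integral_const_mul, laguerreIntegral]
  rw [key]
  refine setIntegral_nonneg measurableSet_Ioi fun x hx => ?_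
  rw [eval_mul]
  exact mul_nonneg (mul_self_nonneg _) (laguerreKernel_pos α a b hT ht hx).le

/-! ### Partial derivatives in the quadrant -/

theorem hasDerivAt_fst {F : ℝ → ℝ → ℝ} {T t : ℝ}
    (h : DifferentiableAt ℝ (fun p : ℝ × ℝ => F p.1 p.2) (T, t)) :
    HasDerivAt (fun x => F x t) (fderiv ℝ (fun p : ℝ × ℝ => F p.1 p.2) (T, t) (1, 0)) T :=
  HasFDerivAt.comp_hasDerivAt (f := fun x => (x, t)) T h.hasFDerivAt
    ((hasDerivAt_id T).prodMk (hasDerivAt_const T t))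

theorem hasDerivAt_snd {F : ℝ → ℝ → ℝ} {T t : ℝ}
    (h : DifferentiableAt ℝ (fun p : ℝ × ℝ => F p.1 p.2) (T, t)) :
    HasDerivAt (fun y => F T y) (fderiv ℝ (fun p : ℝ × ℝ => F p.1 p.2) (T, t) (0, 1)) t :=
  h.hasFDerivAt.comp_hasDerivAt t ((hasDerivAt_const t T).prodMk (hasDerivAt_id t))

theorem partialT_eq_fderiv {F : ℝ → ℝ → ℝ} {T t : ℝ}
    (h : DifferentiableAt ℝ (fun p : ℝ × ℝ => F p.1 p.2) (T, t)) :
    partialT F T t = fderiv ℝ (fun p : ℝ × ℝ => F p.1 p.2) (T, t) (1, 0) :=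
  (hasDerivAt_fst h).deriv

theorem partialt_eq_fderiv {F : ℝ → ℝ → ℝ} {T t : ℝ}
    (h : DifferentiableAt ℝ (fun p : ℝ × ℝ => F p.1 p.2) (T, t)) :
    partialt F T t = fderiv ℝ (fun p : ℝ × ℝ => F p.1 p.2) (T, t) (0, 1) :=
  (hasDerivAt_snd h).deriv

theorem hasDerivAt_partialT {F : ℝ → ℝ → ℝ} {T t : ℝ}
    (h : DifferentiableAt ℝ (fun p : ℝ × ℝ => F p.1 p.2) (T, t)) :
    HasDerivAt (fun x => F x t) (partialT F T t) T :=
  (hasDerivAt_fst h).differentiableAt.hasDerivAt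

theorem hasDerivAt_partialt {F : ℝ → ℝ → ℝ} {T t : ℝ}
    (h : DifferentiableAt ℝ (fun p : ℝ × ℝ => F p.1 p.2) (T, t)) :
    HasDerivAt (fun y => F T y) (partialt F T t) t :=
  (hasDerivAt_snd h).differentiableAt.hasDerivAt

theorem contDiffOn_partialT {F : ℝ → ℝ → ℝ} {s : Set (ℝ × ℝ)} (hs : IsOpen s) {m : ℕ}
    (h : ContDiffOn ℝ (m + 1) (fun p : ℝ × ℝ => F p.1 p.2) s) :
    ContDiffOn ℝ m (fun p : ℝ × ℝ => partialT F p.1 p.2) s :=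
  ((h.fderiv_of_isOpen hs le_rfl).clm_apply contDiffOn_const).congr fun p hp =>
    partialT_eq_fderiv ((h.contDiffAt (hs.mem_nhds hp)).differentiableAt (by simp))

theorem contDiffOn_partialt {F : ℝ → ℝ → ℝ} {s : Set (ℝ × ℝ)} (hs : IsOpen s) {m : ℕ}
    (h : ContDiffOn ℝ (m + 1) (fun p : ℝ × ℝ => F p.1 p.2) s) :
    ContDiffOn ℝ m (fun p : ℝ × ℝ => partialt F p.1 p.2) s :=
  ((h.fderiv_of_isOpen hs le_rfl).clm_apply contDiffOn_const).congr fun p hp =>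
    partialt_eq_fderiv ((h.contDiffAt (hs.mem_nhds hp)).differentiableAt (by simp))

/-- Symmetry of mixed partial derivatives. -/
theorem partialt_partialT_comm {F : ℝ → ℝ → ℝ} {s : Set (ℝ × ℝ)} (hs : IsOpen s)
    (h : ContDiffOn ℝ 2 (fun p : ℝ × ℝ => F p.1 p.2) s) {T t : ℝ} (hp : (T, t) ∈ s) :
    partialt (partialT F) T t = partialT (partialt F) T t := by
  have h' : ContDiffOn ℝ ((1 : ℕ) + 1) (fun p : ℝ × ℝ => F p.1 p.2) s := by
    convert h using 1; norm_num
  have hd : ∀ q ∈ s, DifferentiableAt ℝ (fun p : ℝ × ℝ => F p.1 p.2) q := fun q hq =>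
    (h.contDiffAt (hs.mem_nhds hq)).differentiableAt (by simp)
  have hdd : DifferentiableAt ℝ (fderiv ℝ (fun p : ℝ × ℝ => F p.1 p.2)) (T, t) :=
    ((h'.fderiv_of_isOpen hs le_rfl).contDiffAt (hs.mem_nhds hp)).differentiableAt (by simp)
  have e1 : (fun p : ℝ × ℝ => partialT F p.1 p.2) =ᶠ[nhds (T, t)]
      fun p => fderiv ℝ (fun p : ℝ × ℝ => F p.1 p.2) p (1, 0) := by
    filter_upwards [hs.mem_nhds hp] with q hq using partialT_eq_fderiv (hd q hq)
  have e2 : (fun p : ℝ × ℝ => partialt F p.1 p.2) =ᶠ[nhds (T, t)]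
      fun p => fderiv ℝ (fun p : ℝ × ℝ => F p.1 p.2) p (0, 1) := by
    filter_upwards [hs.mem_nhds hp] with q hq using partialt_eq_fderiv (hd q hq)
  rw [partialt_eq_fderiv (((contDiffOn_partialT hs h').contDiffAt
      (hs.mem_nhds hp)).differentiableAt (by simp)),
    partialT_eq_fderiv (((contDiffOn_partialt hs h').contDiffAt
      (hs.mem_nhds hp)).differentiableAt (by simp)), e1.fderiv_eq, e2.fderiv_eq,
    fderiv_clm_apply hdd (differentiableAt_const _), fderiv_clm_apply hdd (differentiableAt_const _)]
  simp only [fderiv_fun_const, Pi.zero_apply, ContinuousLinearMap.comp_zero, zero_add,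
    ContinuousLinearMap.flip_apply]
  exact ((h.contDiffAt (hs.mem_nhds hp)).isSymmSndFDerivAt (by simp)) _ _

theorem isOpen_quadrant : IsOpen (Ioi (0 : ℝ) ×ˢ Ioi (0 : ℝ)) := isOpen_Ioi.prod isOpen_Ioi

/-- `(T ∂²_{TT} + t ∂²_{Tt}) H = ∂_T β(H)` for every smooth `H`. -/
theorem hasDerivAt_betaOf_fst {H : ℝ → ℝ → ℝ}
    (hH : ContDiffOn ℝ 2 (fun p : ℝ × ℝ => H p.1 p.2) (Ioi 0 ×ˢ Ioi 0)) (n : ℕ) (α : ℝ) {T t : ℝ}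
    (hT : 0 < T) (ht : 0 < t) :
    HasDerivAt (fun x => betaOf n α H x t) (secondOp1 H T t) T := by
  have hH' : ContDiffOn ℝ ((1 : ℕ) + 1) (fun p : ℝ × ℝ => H p.1 p.2) (Ioi 0 ×ˢ Ioi 0) := by
    convert hH using 1; norm_num
  have hn := isOpen_quadrant.mem_nhds (show (T, t) ∈ Ioi (0 : ℝ) ×ˢ Ioi (0 : ℝ) from ⟨hT, ht⟩)
  have h0 := hasDerivAt_partialT ((hH.contDiffAt hn).differentiableAt (by simp))
  have h1 := hasDerivAt_partialT
    (((contDiffOn_partialT isOpen_quadrant hH').contDiffAt hn).differentiableAt (by simp))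
  have h2 := hasDerivAt_partialT
    (((contDiffOn_partialt isOpen_quadrant hH').contDiffAt hn).differentiableAt (by simp))
  refine (((((hasDerivAt_id T).mul h1).add (h2.const_mul t)).sub h0).add_const
    ((n : ℝ) * (n + α))).congr_deriv ?_
  simp only [secondOp1, id]
  ring

/-- `(T ∂²_{Tt} + t ∂²_{tt}) H = ∂_t β(H)` for every smooth `H`. -/
theorem hasDerivAt_betaOf_snd {H : ℝ → ℝ → ℝ}
    (hH : ContDiffOn ℝ 2 (fun p : ℝ × ℝ => H p.1 p.2) (Ioi 0 ×ˢ Ioi 0)) (n : ℕ) (α : ℝ) {T t : ℝ}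
    (hT : 0 < T) (ht : 0 < t) :
    HasDerivAt (fun y => betaOf n α H T y) (secondOp2 H T t) t := by
  have hH' : ContDiffOn ℝ ((1 : ℕ) + 1) (fun p : ℝ × ℝ => H p.1 p.2) (Ioi 0 ×ˢ Ioi 0) := by
    convert hH using 1; norm_num
  have hm : (T, t) ∈ Ioi (0 : ℝ) ×ˢ Ioi (0 : ℝ) := ⟨hT, ht⟩
  have hn := isOpen_quadrant.mem_nhds hm
  have h0 := hasDerivAt_partialt ((hH.contDiffAt hn).differentiableAt (by simp))
  have h1 := hasDerivAt_partialt
    (((contDiffOn_partialT isOpen_quadrant hH').contDiffAt hn).differentiableAt (by simp))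
  have h2 := hasDerivAt_partialt
    (((contDiffOn_partialt isOpen_quadrant hH').contDiffAt hn).differentiableAt (by simp))
  rw [partialt_partialT_comm isOpen_quadrant hH hm] at h1
  refine ((((h1.const_mul T).add ((hasDerivAt_id t).mul h2)).sub h0).add_const
    ((n : ℝ) * (n + α))).congr_deriv ?_
  simp only [secondOp2, id]
  ring

/-! ### The logarithmic derivative of the Hankel determinant -/

theorem contDiffOn_hankelD {α N : ℝ} (hα : -1 < α) (n m : ℕ) :
    ContDiffOn ℝ m (fun p : ℝ × ℝ => hankelD n α N p.1 p.2) (Ioi 0 ×ˢ Ioi 0) := by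
  have h : ContDiffOn ℝ m
      (fun p : ℝ × ℝ => (hankelMatrix (twoTimeMoment α N p.1 p.2) n).det) (Ioi 0 ×ˢ Ioi 0) := by
    simp only [Matrix.det_apply']
    refine ContDiffOn.sum fun σ _ => contDiffOn_const.mul (contDiffOn_prod fun i _ => ?_)
    exact contDiffOn_laguerreIntegral (neg_one_lt_natCast_add hα _) m N (-N)
  exact h.congr fun p hp => hankelD_eq_det hp.1 hp.2 n

theorem contDiffOn_log_hankelD {α N : ℝ} (hα : -1 < α) (n m : ℕ) :
    ContDiffOn ℝ m (fun p : ℝ × ℝ => Real.log (hankelD n α N p.1 p.2)) (Ioi 0 ×ˢ Ioi 0) :=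
  (contDiffOn_hankelD hα n m).log fun _ hp => (hankelD_pos hα hp.1 hp.2 n).ne'

theorem contDiffOn_hankelH {α N : ℝ} (hα : -1 < α) (n m : ℕ) :
    ContDiffOn ℝ m (fun p : ℝ × ℝ => hankelH n α N p.1 p.2) (Ioi 0 ×ˢ Ioi 0) := by
  have h : ContDiffOn ℝ ((m : WithTop ℕ∞) + 1)
      (fun p : ℝ × ℝ => Real.log (hankelD n α N p.1 p.2)) (Ioi 0 ×ˢ Ioi 0) := by
    exact_mod_cast contDiffOn_log_hankelD hα n (m + 1)
  exact (contDiffOn_fst.mul (contDiffOn_partialT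
    (F := fun T t => Real.log (hankelD n α N T t)) isOpen_quadrant h)).add
    (contDiffOn_snd.mul (contDiffOn_partialt
    (F := fun T t => Real.log (hankelD n α N T t)) isOpen_quadrant h))

theorem hasDerivAt_log_hankelD_fst {α N T t : ℝ} (hα : -1 < α) (hT : 0 < T) (ht : 0 < t) (n : ℕ) :
    HasDerivAt (fun x => Real.log (hankelD n α N x t))
      (∑ j ∈ Finset.range n, -N * momentFunctional (twoTimeMomentT α N T t)
        (orthPoly (twoTimeMoment α N T t) j * orthPoly (twoTimeMoment α N T t) j) /
        sqNorm (twoTimeMoment α N T t) j) T := by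
  have h := hasDerivAt_log_det (μ := fun x => twoTimeMoment α N x t)
    (hasDerivAt_twoTimeMoment_fst hα hT ht) (isTwoTimeLaguerre hα hT ht).det_ne_zero n
  simp only [momentFunctional_const_mul] at h
  refine h.congr_of_eventuallyEq ?_
  filter_upwards [Ioi_mem_nhds hT] with x hx
  rw [hankelD_eq_det hx ht]

theorem hasDerivAt_log_hankelD_snd {α N T t : ℝ} (hα : -1 < α) (hT : 0 < T) (ht : 0 < t) (n : ℕ) :
    HasDerivAt (fun y => Real.log (hankelD n α N T y))
      (∑ j ∈ Finset.range n, N * momentFunctional (twoTimeMomentt α N T t)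
        (orthPoly (twoTimeMoment α N T t) j * orthPoly (twoTimeMoment α N T t) j) /
        sqNorm (twoTimeMoment α N T t) j) t := by
  have h := hasDerivAt_log_det (μ := fun y => twoTimeMoment α N T y)
    (hasDerivAt_twoTimeMoment_snd hα hT ht) (isTwoTimeLaguerre hα hT ht).det_ne_zero n
  simp only [momentFunctional_const_mul] at h
  refine h.congr_of_eventuallyEq ?_
  filter_upwards [Ioi_mem_nhds ht] with y hy
  rw [hankelD_eq_det hT hy]

/-- `H_n` is, up to a constant, the subleading coefficient of `P_n`. -/
theorem hankelH_eq_subCoeff {α N T t : ℝ} (hα : -1 < α) (hT : 0 < T) (ht : 0 < t) (n : ℕ) :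
    hankelH n α N T t = n * (n + α) + subCoeff (twoTimeMoment α N T t) n := by
  have hL := isTwoTimeLaguerre (N := N) hα hT ht
  rw [hankelH, eulerOp, partialT, partialt, (hasDerivAt_log_hankelD_fst hα hT ht n).deriv,
    (hasDerivAt_log_hankelD_snd hα hT ht n).deriv]
  induction n with
  | zero => simp [subCoeff_zero]
  | succ n ih =>
    rw [Finset.sum_range_succ, Finset.sum_range_succ]
    have h := hL.pearson_sq n
    have h0 := sqNorm_ne_zero hL.det_ne_zero n
    have h1 : t * (N * momentFunctional (twoTimeMomentt α N T t)
        (orthPoly (twoTimeMoment α N T t) n * orthPoly (twoTimeMoment α N T t) n) /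
        sqNorm (twoTimeMoment α N T t) n) + T * (-N * momentFunctional (twoTimeMomentT α N T t)
        (orthPoly (twoTimeMoment α N T t) n * orthPoly (twoTimeMoment α N T t) n) /
        sqNorm (twoTimeMoment α N T t) n) = 2 * n + 1 + α - subCoeff (twoTimeMoment α N T t) n +
          subCoeff (twoTimeMoment α N T t) (n + 1) := by
      field_simp
      linear_combination h
    push_cast
    linear_combination ih + h1

theorem hasDerivAt_hankelH_fst {α N T t : ℝ} (hα : -1 < α) (hT : 0 < T) (ht : 0 < t) (n : ℕ) :
    HasDerivAt (fun x => hankelH (n + 1) α N x t)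
      (N * momentFunctional (twoTimeMomentT α N T t)
        (orthPoly (twoTimeMoment α N T t) (n + 1) * orthPoly (twoTimeMoment α N T t) n) /
        sqNorm (twoTimeMoment α N T t) n) T := by
  have h := (hasDerivAt_subCoeff (μ := fun x => twoTimeMoment α N x t)
    (hasDerivAt_twoTimeMoment_fst hα hT ht) (isTwoTimeLaguerre hα hT ht).det_ne_zero n).const_add
    (((n + 1 : ℕ) : ℝ) * ((n + 1 : ℕ) + α))
  rw [momentFunctional_const_mul, neg_mul, neg_neg] at h
  refine h.congr_of_eventuallyEq ?_
  filter_upwards [Ioi_mem_nhds hT] with x hx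
  rw [hankelH_eq_subCoeff hα hx ht]

theorem hasDerivAt_hankelH_snd {α N T t : ℝ} (hα : -1 < α) (hT : 0 < T) (ht : 0 < t) (n : ℕ) :
    HasDerivAt (fun y => hankelH (n + 1) α N T y)
      (-(N * momentFunctional (twoTimeMomentt α N T t)
        (orthPoly (twoTimeMoment α N T t) (n + 1) * orthPoly (twoTimeMoment α N T t) n)) /
        sqNorm (twoTimeMoment α N T t) n) t := by
  have h := (hasDerivAt_subCoeff (μ := fun y => twoTimeMoment α N T y)
    (hasDerivAt_twoTimeMoment_snd hα hT ht) (isTwoTimeLaguerre hα hT ht).det_ne_zero n).const_add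
    (((n + 1 : ℕ) : ℝ) * ((n + 1 : ℕ) + α))
  rw [momentFunctional_const_mul] at h
  refine h.congr_of_eventuallyEq ?_
  filter_upwards [Ioi_mem_nhds ht] with y hy
  rw [hankelH_eq_subCoeff hα hT hy]

/-- `β(H_n)` is the recurrence coefficient `h_n / h_{n-1}`. -/
theorem betaOf_hankelH {α N T t : ℝ} (hα : -1 < α) (hT : 0 < T) (ht : 0 < t) (n : ℕ) :
    betaOf (n + 1) α (hankelH (n + 1) α N) T t =
      sqNorm (twoTimeMoment α N T t) (n + 1) / sqNorm (twoTimeMoment α N T t) n := by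
  have hL := isTwoTimeLaguerre (N := N) hα hT ht
  rw [betaOf, partialT, partialt, (hasDerivAt_hankelH_fst hα hT ht n).deriv,
    (hasDerivAt_hankelH_snd hα hT ht n).deriv, hankelH_eq_subCoeff hα hT ht]
  have h := hL.pearson_mul n
  have h0 := sqNorm_ne_zero hL.det_ne_zero n
  field_simp
  push_cast
  linear_combination -h

theorem betaOf_hankelH_pos {α N T t : ℝ} (hα : -1 < α) (hT : 0 < T) (ht : 0 < t) (n : ℕ) :
    0 < betaOf (n + 1) α (hankelH (n + 1) α N) T t := by
  rw [betaOf_hankelH hα hT ht]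
  exact div_pos (sqNorm_twoTimeMoment_pos hα hT ht _) (sqNorm_twoTimeMoment_pos hα hT ht _)

/-- `(T ∂²_{TT} + t ∂²_{Tt}) H_n`, as the derivative `∂_T (h_n / h_{n-1})`. -/
theorem secondOp1_hankelH {α N T t : ℝ} (hα : -1 < α) (hT : 0 < T) (ht : 0 < t) (n : ℕ) :
    secondOp1 (hankelH (n + 1) α N) T t =
      sqNorm (twoTimeMoment α N T t) (n + 1) / sqNorm (twoTimeMoment α N T t) n *
      (N * momentFunctional (twoTimeMomentT α N T t)
        (orthPoly (twoTimeMoment α N T t) n * orthPoly (twoTimeMoment α N T t) n) /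
          sqNorm (twoTimeMoment α N T t) n -
       N * momentFunctional (twoTimeMomentT α N T t)
        (orthPoly (twoTimeMoment α N T t) (n + 1) * orthPoly (twoTimeMoment α N T t) (n + 1)) /
          sqNorm (twoTimeMoment α N T t) (n + 1)) := by
  have hL := isTwoTimeLaguerre (N := N) hα hT ht
  have hd := hasDerivAt_sqNorm (μ := fun x => twoTimeMoment α N x t)
    (hasDerivAt_twoTimeMoment_fst hα hT ht) hL.det_ne_zero
  have h := ((hd (n + 1)).div (hd n) (sqNorm_ne_zero hL.det_ne_zero n)).congr_of_eventuallyEq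
    (f₁ := fun x => betaOf (n + 1) α (hankelH (n + 1) α N) x t) (by
      filter_upwards [Ioi_mem_nhds hT] with x hx using betaOf_hankelH hα hx ht n)
  have h' := hasDerivAt_betaOf_fst (contDiffOn_hankelH (N := N) hα (n + 1) 2) (n + 1) α hT ht
  have h0 := sqNorm_ne_zero hL.det_ne_zero n
  have h1 := sqNorm_ne_zero hL.det_ne_zero (n + 1)
  rw [h'.unique h, momentFunctional_const_mul, momentFunctional_const_mul]
  field_simp
  ring

/-- `(T ∂²_{Tt} + t ∂²_{tt}) H_n`, as the derivative `∂_t (h_n / h_{n-1})`. -/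
theorem secondOp2_hankelH {α N T t : ℝ} (hα : -1 < α) (hT : 0 < T) (ht : 0 < t) (n : ℕ) :
    secondOp2 (hankelH (n + 1) α N) T t =
      sqNorm (twoTimeMoment α N T t) (n + 1) / sqNorm (twoTimeMoment α N T t) n *
      (N * momentFunctional (twoTimeMomentt α N T t)
        (orthPoly (twoTimeMoment α N T t) (n + 1) * orthPoly (twoTimeMoment α N T t) (n + 1)) /
          sqNorm (twoTimeMoment α N T t) (n + 1) -
       N * momentFunctional (twoTimeMomentt α N T t)
        (orthPoly (twoTimeMoment α N T t) n * orthPoly (twoTimeMoment α N T t) n) /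
          sqNorm (twoTimeMoment α N T t) n) := by
  have hL := isTwoTimeLaguerre (N := N) hα hT ht
  have hd := hasDerivAt_sqNorm (μ := fun y => twoTimeMoment α N T y)
    (hasDerivAt_twoTimeMoment_snd hα hT ht) hL.det_ne_zero
  have h := ((hd (n + 1)).div (hd n) (sqNorm_ne_zero hL.det_ne_zero n)).congr_of_eventuallyEq
    (f₁ := fun y => betaOf (n + 1) α (hankelH (n + 1) α N) T y) (by
      filter_upwards [Ioi_mem_nhds ht] with y hy using betaOf_hankelH hα hT hy n)
  have h' := hasDerivAt_betaOf_snd (contDiffOn_hankelH (N := N) hα (n + 1) 2) (n + 1) α hT ht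
  have h0 := sqNorm_ne_zero hL.det_ne_zero n
  have h1 := sqNorm_ne_zero hL.det_ne_zero (n + 1)
  rw [h'.unique h, momentFunctional_const_mul, momentFunctional_const_mul]
  field_simp

/-! ### The double-time equation -/

/-- With `p = ∂_T H`, `q = ∂_t H`, `β = β(H)` and auxiliary quantities `S, S', R, R'`
(the values on `P_n² / h_n` and `P_{n-1}² / h_{n-1}` of the functionals with weights
`N w / (x + T)` and `N w / (x + t)`), three quadratic relations, one for each finite
singular point of the weight, amount to the double-time equation. -/
theorem doubleTime_of_quadratic_relations {n : ℕ} {α N T t ε β S S' R R' A₁ A₂ : ℝ}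
    {H : ℝ → ℝ → ℝ} (hε : ε ^ 2 = 1) (hβ : 0 < β) (hβH : betaOf n α H T t = β)
    (h1 : secondOp1 H T t = β * (S' - S)) (h2 : secondOp2 H T t = β * (R - R'))
    (hT : β * (S * S') = partialT H T t * (partialT H T t - N))
    (ht : β * (R * R') = partialt H T t * (partialt H T t + N))
    (h0 : β * ((1 - R + S) * (1 - R' + S')) = (-n + partialt H T t + partialT H T t) *
      (-n + partialt H T t + partialT H T t - α))
    (hA₁ : A₁ = ε * (β * (S + S'))) (hA₂ : A₂ = ε * (β * (R + R'))) :
    H T t = doubleTimeRHS n α N H ε A₁ A₂ T t := by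
  have hb := hβH
  rw [betaOf] at hb
  have hfrac : (secondOp1 H T t * secondOp2 H T t + A₁ * A₂) / (2 * betaOf n α H T t) =
      β * (S' * R + S * R') := by
    rw [hβH, h1, h2, hA₁, hA₂, div_eq_iff (by positivity)]
    linear_combination β ^ 2 * (S + S') * (R + R') * hε
  rw [doubleTimeRHS, hfrac, hA₁, hA₂]
  linear_combination (-1 : ℝ) * hb - h0 + hT + ht - β * (S + S' - R - R') * hε

/-- The relation at `-T` makes the first radicand a perfect square, `(S' - S)² + 4 S S' = (S + S')²`
up to `β²`. -/
theorem radicand1_eq_sq {n : ℕ} {α N T t β S S' : ℝ} {H : ℝ → ℝ → ℝ}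
    (hβH : betaOf n α H T t = β) (h1 : secondOp1 H T t = β * (S' - S))
    (hT : β * (S * S') = partialT H T t * (partialT H T t - N)) :
    radicand1 n α N H T t = (β * (S + S')) ^ 2 := by
  rw [radicand1, hβH, h1]
  linear_combination -4 * β * hT

/-- The relation at `-t` makes the second radicand a perfect square. -/
theorem radicand2_eq_sq {n : ℕ} {α N T t β R R' : ℝ} {H : ℝ → ℝ → ℝ}
    (hβH : betaOf n α H T t = β) (h2 : secondOp2 H T t = β * (R - R'))
    (ht : β * (R * R') = partialt H T t * (partialt H T t + N)) :
    radicand2 n α N H T t = (β * (R + R')) ^ 2 := by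
  rw [radicand2, hβH, h2]
  linear_combination -4 * β * ht

/-- The double-time equation for `H_{n+1}`. The square roots are taken out with the sign that makes
`A₁ = ε β (S + S')` and `A₂ = ε β (R + R')`, where `S, S', R, R' ≥ 0` are values of positive
functionals on squares. -/
theorem doubleTime_hankelH {α N T t : ℝ} (hα : -1 < α) (hN : 0 < N) (hT : 0 < T) (ht : 0 < t)
    (n : ℕ) :
    0 ≤ radicand1 (n + 1) α N (hankelH (n + 1) α N) T t ∧
    0 ≤ radicand2 (n + 1) α N (hankelH (n + 1) α N) T t ∧
    ∀ ε : ℝ, ε ^ 2 = 1 → hankelH (n + 1) α N T t =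
      doubleTimeRHS (n + 1) α N (hankelH (n + 1) α N) ε
        (ε * √(radicand1 (n + 1) α N (hankelH (n + 1) α N) T t))
        (ε * √(radicand2 (n + 1) α N (hankelH (n + 1) α N) T t)) T t := by
  have hL := isTwoTimeLaguerre (N := N) hα hT ht
  have hβH := betaOf_hankelH (N := N) hα hT ht n
  have h1 := secondOp1_hankelH (N := N) hα hT ht n
  have h2 := secondOp2_hankelH (N := N) hα hT ht n
  have hp : partialT (hankelH (n + 1) α N) T t = _ := (hasDerivAt_hankelH_fst hα hT ht n).deriv
  have hq : partialt (hankelH (n + 1) α N) T t = _ := (hasDerivAt_hankelH_snd hα hT ht n).deriv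
  have qT := hL.quad_T n
  have qt := hL.quad_t n
  have q0 := hL.quad_zero n
  have hh := sqNorm_twoTimeMoment_pos (N := N) hα hT ht (n + 1)
  have hk := sqNorm_twoTimeMoment_pos (N := N) hα hT ht n
  have nT : ∀ f, 0 ≤ momentFunctional (twoTimeMomentT α N T t) (f * f) :=
    momentFunctional_sq_nonneg hα N (-N - 1) hT ht
  have nt : ∀ f, 0 ≤ momentFunctional (twoTimeMomentt α N T t) (f * f) :=
    momentFunctional_sq_nonneg hα (N - 1) (-N) hT ht
  have nT1 := nT (orthPoly (twoTimeMoment α N T t) (n + 1))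
  have nT0 := nT (orthPoly (twoTimeMoment α N T t) n)
  have nt1 := nt (orthPoly (twoTimeMoment α N T t) (n + 1))
  have nt0 := nt (orthPoly (twoTimeMoment α N T t) n)
  generalize momentFunctional (twoTimeMomentT α N T t)
    (orthPoly (twoTimeMoment α N T t) (n + 1) * orthPoly (twoTimeMoment α N T t) (n + 1)) = a at *
  generalize momentFunctional (twoTimeMomentT α N T t)
    (orthPoly (twoTimeMoment α N T t) n * orthPoly (twoTimeMoment α N T t) n) = a' at *
  generalize momentFunctional (twoTimeMomentT α N T t)
    (orthPoly (twoTimeMoment α N T t) (n + 1) * orthPoly (twoTimeMoment α N T t) n) = b at *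
  generalize momentFunctional (twoTimeMomentt α N T t)
    (orthPoly (twoTimeMoment α N T t) (n + 1) * orthPoly (twoTimeMoment α N T t) (n + 1)) = c at *
  generalize momentFunctional (twoTimeMomentt α N T t)
    (orthPoly (twoTimeMoment α N T t) n * orthPoly (twoTimeMoment α N T t) n) = c' at *
  generalize momentFunctional (twoTimeMomentt α N T t)
    (orthPoly (twoTimeMoment α N T t) (n + 1) * orthPoly (twoTimeMoment α N T t) n) = d at *
  generalize sqNorm (twoTimeMoment α N T t) (n + 1) = h at *
  generalize sqNorm (twoTimeMoment α N T t) n = k at *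
  -- the relations at the singular points `-T`, `-t` and `0`
  have eT : h / k * (N * a / h * (N * a' / k)) = partialT (hankelH (n + 1) α N) T t *
      (partialT (hankelH (n + 1) α N) T t - N) := by
    rw [hp]
    field_simp
    linear_combination qT
  have et : h / k * (N * c / h * (N * c' / k)) = partialt (hankelH (n + 1) α N) T t *
      (partialt (hankelH (n + 1) α N) T t + N) := by
    rw [hq]
    field_simp
    linear_combination qt
  have e0 : h / k * ((1 - N * c / h + N * a / h) * (1 - N * c' / k + N * a' / k)) =
      (-((n + 1 : ℕ) : ℝ) + partialt (hankelH (n + 1) α N) T t +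
        partialT (hankelH (n + 1) α N) T t) * (-((n + 1 : ℕ) : ℝ) +
        partialt (hankelH (n + 1) α N) T t + partialT (hankelH (n + 1) α N) T t - α) := by
    rw [hp, hq]
    field_simp
    push_cast
    linear_combination q0
  have r1 := radicand1_eq_sq hβH h1 eT
  have r2 := radicand2_eq_sq hβH h2 et
  have p1 : 0 ≤ h / k * (N * a / h + N * a' / k) := by positivity
  have p2 : 0 ≤ h / k * (N * c / h + N * c' / k) := by positivity
  refine ⟨r1 ▸ sq_nonneg _, r2 ▸ sq_nonneg _, fun ε hε => ?_⟩
  exact doubleTime_of_quadratic_relations hε (div_pos hh hk) hβH h1 h2 eT et e0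
    (by rw [r1, Real.sqrt_sq p1]) (by rw [r2, Real.sqrt_sq p2])

/-! ### The moment generating function -/

theorem weightLag_eq_weightAF (α x : ℝ) : weightLag α x = weightAF α 0 1 1 x := by
  simp [weightLag, weightAF]

theorem hankelDet_weightLag_pos {α : ℝ} (hα : -1 < α) (n : ℕ) :
    0 < hankelDet n (weightLag α) := by
  rw [show weightLag α = weightAF α 0 1 1 from funext (weightLag_eq_weightAF α)]
  exact hankelD_pos hα one_pos one_pos n

theorem mgfSNR_eq {α N T t : ℝ} (hα : -1 < α) (hT : 0 < T) (ht : 0 < t) (n : ℕ) :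
    mgfSNR n α N T t =
      (T / t) ^ ((n : ℝ) * N) * (hankelD n α N T t / hankelDet n (weightLag α)) := by
  rw [mgfSNR, multipleIntegral_eq_hankelDet (integrableOn_pow_mul_weightAF hα hT ht),
    multipleIntegral_eq_hankelDet, hankelD]
  rw [show weightLag α = weightAF α 0 1 1 from funext (weightLag_eq_weightAF α)]
  exact integrableOn_pow_mul_weightAF hα one_pos one_pos

theorem mgfSNR_pos {α N T t : ℝ} (hα : -1 < α) (hT : 0 < T) (ht : 0 < t) (n : ℕ) :
    0 < mgfSNR n α N T t := by
  rw [mgfSNR_eq hα hT ht]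
  have := hankelD_pos (N := N) hα hT ht n
  have := hankelDet_weightLag_pos hα n
  positivity

theorem contDiffOn_mgfSNR {α N : ℝ} (hα : -1 < α) (n m : ℕ) :
    ContDiffOn ℝ m (fun p : ℝ × ℝ => mgfSNR n α N p.1 p.2) (Ioi 0 ×ˢ Ioi 0) := by
  have h1 : ContDiffOn ℝ m (fun p : ℝ × ℝ => (p.1 / p.2) ^ ((n : ℝ) * N)) (Ioi 0 ×ˢ Ioi 0) :=
    (contDiffOn_fst.div contDiffOn_snd fun p hp => (ne_of_gt hp.2)).rpow_const_of_ne
      fun p hp => (div_pos hp.1 hp.2).ne'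
  exact (h1.mul ((contDiffOn_hankelD hα n m).div_const _)).congr fun p hp =>
    mgfSNR_eq hα hp.1 hp.2 n

theorem log_mgfSNR {α N T t : ℝ} (hα : -1 < α) (hT : 0 < T) (ht : 0 < t) (n : ℕ) :
    Real.log (mgfSNR n α N T t) = n * N * (Real.log T - Real.log t) +
      Real.log (hankelD n α N T t) - Real.log (hankelDet n (weightLag α)) := by
  have h1 := hankelD_pos (N := N) hα hT ht n
  have h2 := hankelDet_weightLag_pos hα n
  rw [mgfSNR_eq hα hT ht, Real.log_mul (by positivity) (by positivity), Real.log_rpow (by positivity),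
    Real.log_div hT.ne' ht.ne', Real.log_div h1.ne' h2.ne']
  ring

theorem hankelH_eq_eulerOp_log_mgfSNR {α N T t : ℝ} (hα : -1 < α) (hT : 0 < T) (ht : 0 < t)
    (n : ℕ) : hankelH n α N T t = eulerOp (fun T t => Real.log (mgfSNR n α N T t)) T t := by
  have d1 := hasDerivAt_log_hankelD_fst (N := N) hα hT ht n
  have d2 := hasDerivAt_log_hankelD_snd (N := N) hα hT ht n
  have e1 := (((((Real.hasDerivAt_log hT.ne').sub_const (Real.log t)).const_mul (n * N)).add
    d1).sub_const (Real.log (hankelDet n (weightLag α)))).congr_of_eventuallyEq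
    (f₁ := fun x => Real.log (mgfSNR n α N x t)) (by
      filter_upwards [Ioi_mem_nhds hT] with x hx using log_mgfSNR hα hx ht n)
  have e2 := (((((Real.hasDerivAt_log ht.ne').const_sub (Real.log T)).const_mul (n * N)).add
    d2).sub_const (Real.log (hankelDet n (weightLag α)))).congr_of_eventuallyEq
    (f₁ := fun y => Real.log (mgfSNR n α N T y)) (by
      filter_upwards [Ioi_mem_nhds ht] with y hy using log_mgfSNR hα hT hy n)
  rw [hankelH, eulerOp, eulerOp, partialT, partialt, partialT, partialt, d1.deriv, d2.deriv,
    e1.deriv, e2.deriv]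
  field_simp
  ring

/-! ### Reduction to Painlevé V -/

/-- For `H(T, t) = Y(T)` the root `A₂` vanishes, and the equation says that
`Y - (2 n - N + α + T) Y'` is a square root of the first radicand. -/
theorem satisfiesDoubleTime_fst_iff (n : ℕ) (α N : ℝ) (Y : ℝ → ℝ) (T t : ℝ)
    (hβ : T * deriv Y T - Y T + n * (n + α) ≠ 0) :
    SatisfiesDoubleTime n α N (fun x _ => Y x) T t ↔ SatisfiesSigmaPV 0 (-n - α) (-n) (-N) Y T := by
  have hp : partialT (fun x _ => Y x) = fun x _ => deriv Y x := rfl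
  have hq : partialt (fun x _ => Y x) = fun _ _ => 0 := by
    funext x y; simp [partialt]
  have hpp : partialT (fun x _ => deriv Y x) = fun x _ => deriv (deriv Y) x := rfl
  have h0 : partialT (fun _ _ => 0) = fun _ _ => 0 := by funext x y; simp [partialT]
  have h0' : partialt (fun _ _ => 0) = fun _ _ => 0 := by funext x y; simp [partialt]
  simp only [SatisfiesDoubleTime, SatisfiesSigmaPV, doubleTimeRHS, radicand1, radicand2, secondOp1,
    secondOp2, betaOf, hp, hq, hpp, h0, h0', mul_zero, add_zero, zero_add, zero_mul, ne_eq,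
    OfNat.ofNat_ne_zero, not_false_eq_true, zero_pow, sq_eq_zero_iff]
  constructor
  · rintro ⟨-, ε, A₁, A₂, hε, h1, rfl, h⟩
    have hε2 : ε ^ 2 = 1 := by rcases hε with rfl | rfl <;> norm_num
    simp only [mul_zero, zero_div, sub_zero] at h
    have h3 : Y T - (2 * n - N + α + T) * deriv Y T = ε * A₁ := by linear_combination h
    have h4 : (Y T - (2 * n - N + α + T) * deriv Y T) ^ 2 = A₁ ^ 2 := by
      rw [h3]; linear_combination A₁ ^ 2 * hε2
    linear_combination (-1 : ℝ) * h1 - h4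
  · intro h
    refine ⟨hβ, 1, Y T - (2 * n - N + α + T) * deriv Y T, 0, Or.inl rfl, ?_, rfl, ?_⟩
    · linear_combination -h
    · simp only [mul_zero, zero_div, sub_zero]; ring

/-- For `H(T, t) = Y(t)` the root `A₁` vanishes, and the equation says that
`Y - (2 n + N + α + t) Y'` is a square root of the second radicand. -/
theorem satisfiesDoubleTime_snd_iff (n : ℕ) (α N : ℝ) (Y : ℝ → ℝ) (T t : ℝ)
    (hβ : t * deriv Y t - Y t + n * (n + α) ≠ 0) :
    SatisfiesDoubleTime n α N (fun _ y => Y y) T t ↔ SatisfiesSigmaPV 0 (-n - α) (-n) N Y t := by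
  have hq : partialt (fun _ y => Y y) = fun _ y => deriv Y y := rfl
  have hp : partialT (fun _ y => Y y) = fun _ _ => 0 := by
    funext x y; simp [partialT]
  have hqq : partialt (fun _ y => deriv Y y) = fun _ y => deriv (deriv Y) y := rfl
  have hpq : partialT (fun _ y => deriv Y y) = fun _ _ => 0 := by funext x y; simp [partialT]
  have h0 : partialT (fun _ _ => 0) = fun _ _ => 0 := by funext x y; simp [partialT]
  simp only [SatisfiesDoubleTime, SatisfiesSigmaPV, doubleTimeRHS, radicand1, radicand2, secondOp1,
    secondOp2, betaOf, hp, hq, hqq, hpq, h0, mul_zero, add_zero, zero_add, zero_mul, ne_eq,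
    OfNat.ofNat_ne_zero, not_false_eq_true, zero_pow, sq_eq_zero_iff]
  constructor
  · rintro ⟨-, ε, A₁, A₂, hε, rfl, h2, h⟩
    have hε2 : ε ^ 2 = 1 := by rcases hε with rfl | rfl <;> norm_num
    simp only [mul_zero, zero_mul, zero_div, sub_zero, add_zero] at h
    have h3 : Y t - (2 * n + N + α + t) * deriv Y t = -(ε * A₂) := by linear_combination h
    have h4 : (Y t - (2 * n + N + α + t) * deriv Y t) ^ 2 = A₂ ^ 2 := by
      rw [h3]; linear_combination A₂ ^ 2 * hε2
    linear_combination (-1 : ℝ) * h2 - h4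
  · intro h
    refine ⟨hβ, 1, 0, (2 * n + N + α + t) * deriv Y t - Y t, Or.inl rfl, rfl, ?_, ?_⟩
    · linear_combination -h
    · simp only [zero_mul, zero_div, sub_zero]; ring

end

theorem theorem1 (n : ℕ) (hn : 1 ≤ n) (α N : ℝ) (hα : -1 < α) (hN : 0 < N) :
    -- all quantities are well defined and smooth enough for the equations below
    (∀ T t : ℝ, 0 < T → 0 < t →
      (∀ k : ℕ, MeasureTheory.IntegrableOn (fun x => x ^ k * weightAF α N T t x) (Set.Ici 0)) ∧
      0 < hankelD n α N T t ∧ 0 < mgfSNR n α N T t) ∧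
    ContDiffOn ℝ 3 (fun p : ℝ × ℝ => hankelD n α N p.1 p.2) (Set.Ioi 0 ×ˢ Set.Ioi 0) ∧
    ContDiffOn ℝ 3 (fun p : ℝ × ℝ => mgfSNR n α N p.1 p.2) (Set.Ioi 0 ×ˢ Set.Ioi 0) ∧
    ContDiffOn ℝ 2 (fun p : ℝ × ℝ => hankelH n α N p.1 p.2) (Set.Ioi 0 ×ˢ Set.Ioi 0) ∧
    -- `H_n` is also the same logarithmic derivative of the moment generating function
    (∀ T t : ℝ, 0 < T → 0 < t →
      hankelH n α N T t = eulerOp (fun T t => Real.log (mgfSNR n α N T t)) T t) ∧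
    -- the double-time equation: upper sign for the nonnegative square roots,
    -- lower sign for the nonpositive ones
    (∀ T t : ℝ, 0 < T → 0 < t →
      betaOf n α (hankelH n α N) T t ≠ 0 ∧
      0 ≤ radicand1 n α N (hankelH n α N) T t ∧
      0 ≤ radicand2 n α N (hankelH n α N) T t ∧
      hankelH n α N T t =
        doubleTimeRHS n α N (hankelH n α N) 1
          (√(radicand1 n α N (hankelH n α N) T t))
          (√(radicand2 n α N (hankelH n α N) T t)) T t ∧
      hankelH n α N T t =
        doubleTimeRHS n α N (hankelH n α N) (-1)
          (-√(radicand1 n α N (hankelH n α N) T t))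
          (-√(radicand2 n α N (hankelH n α N) T t)) T t) ∧
    -- reduction of the equation for functions of `T` only
    (∀ (Y : ℝ → ℝ) (T t : ℝ), 0 < T → 0 < t → ContDiffAt ℝ 2 Y T →
      T * deriv Y T - Y T + n * (n + α) ≠ 0 →
      (SatisfiesDoubleTime n α N (fun x _ => Y x) T t ↔
        SatisfiesSigmaPV 0 (-n - α) (-n) (-N) Y T)) ∧
    -- reduction of the equation for functions of `t` only
    (∀ (Y : ℝ → ℝ) (T t : ℝ), 0 < T → 0 < t → ContDiffAt ℝ 2 Y t →
      t * deriv Y t - Y t + n * (n + α) ≠ 0 →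
      (SatisfiesDoubleTime n α N (fun _ y => Y y) T t ↔
        SatisfiesSigmaPV 0 (-n - α) (-n) N Y t)) := by
  obtain ⟨n, rfl⟩ : ∃ m, n = m + 1 := ⟨n - 1, by omega⟩
  refine ⟨fun T t hT ht => ⟨integrableOn_pow_mul_weightAF hα hT ht, hankelD_pos hα hT ht _,
    mgfSNR_pos hα hT ht _⟩, contDiffOn_hankelD hα _ 3, contDiffOn_mgfSNR hα _ 3,
    contDiffOn_hankelH hα _ 2, fun T t hT ht => hankelH_eq_eulerOp_log_mgfSNR hα hT ht _,
    fun T t hT ht => ?_, fun Y T t _ _ _ hβ => satisfiesDoubleTime_fst_iff _ α N Y T t hβ,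
    fun Y T t _ _ _ hβ => satisfiesDoubleTime_snd_iff _ α N Y T t hβ⟩
  obtain ⟨h1, h2, h⟩ := doubleTime_hankelH hα hN hT ht n
  refine ⟨(betaOf_hankelH_pos hα hT ht n).ne', h1, h2, ?_, ?_⟩
  · simpa only [one_mul] using h 1 (by norm_num)
  · simpa only [neg_one_mul] using h (-1) (by norm_num)
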